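/- Let $\Gamma=\mathbb Z_2*\mathbb Z_2*\mathbb Z_2*\mathbb Z_2$ with generators $A,B,C,D$ of order two, and let $\widetilde\Gamma=\langle A,B,C\rangle$. A $4$-colored graph is a simple graph with a proper edge-coloring by $A,B,C,D$. It carries an action $\Phi$ of $\Gamma$ on its vertices: a generator moves a vertex along the incident edge of that color, and fixes it if there is no such edge. Fix an integer $m>10$. Consider the following construction of $4$-colored graphs $G_0\subset G_1\subset G_2\subset\cdots$ with distinguished vertices $r_n\in V(G_n)$. Choose normal subgroups $N_1\ge N_2\ge\cdots$ of finite index in $\widetilde\Gamma$ with $\bigcap_i N_i=\{1\}$. Let $K_i$ be the Cayley graph of $\widetilde\Gamma/N_i$, colored by $A,B,C$, and let $C_i$ be the cycle of length $2i$, colored alternately by $A$ and $B$. Let $\underline w_1,\underline w_2,\dots=A,B,C,D,AB,AC,AD,BA,\dots$ be the nontrivial reduced words of $\Gamma$, ordered by length and then lexicographically. For $i\ge1$ put $s_i=m^i2^{|V(G_{i-1})|}$. * $G_0$ is a single vertex $p=r_0$. $G_1$ is a triangle with edges colored $A,B,C$, one vertex $q$ of which is joined to $p$ by an edge colored $D$;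 $r_1\ne q$ is another vertex of the triangle. * Step $n\ge2$. Choose a $4$-colored graph $H_n$ isomorphic to some $C_i$ if $n$ is even, and to some $K_i$ if $n$ is odd, with $\operatorname{diam}H_n\ge10s_n$. Choose a partition $V(H_n)=R_1\sqcup\dots\sqcup R_{n+1}$ such that, for $1\le i\le n$, distinct points of $R_i$ are at distance at least $2s_i$ in $H_n$ and every vertex of $H_n$ is within distance $10s_i$ of $R_i$. For $1\le i\le n-1$ attach to each vertex of $R_i$ a separate copy of $G_{i-1}$, by an edge colored $D$ ending at its vertex $r_{i-1}$. Attach one copy of $G_{n-1}$ to one vertex of $R_n$, by an edge colored $D$ ending at $r_{n-1}$; this copy gives the inclusion $G_{n-1}\subset G_n$. Choose distinct $x_n,r_n\in R_{n+1}$. Write $\underline w_{n-1}=w_k\cdots w_1$. If $w_1\ne D$, join $x_n$ by an edge colored $D$ to the first vertex $y_0$ of a new path $y_0,y_1,\dots,y_k$; if $w_1=D$, join $x_n$ by an edge colored $D$ to the first vertex $y_1$ of a new path $y_1,\dots,y_k$. In both cases the edge $(y_i,y_{i+1})$ is colored $w_{i+1}$. The result is $G_n$. Let $G=\bigcup_nG_n$.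 For a finite $\Omega\subset V(G)$ let $\partial\Omega$ be the set of vertices of $\Omega$ having a neighbor outside $\Omega$. **Proposition.** For every $m>10$ the construction can be carried out. For every outcome of it, the action $\Phi$ of $\Gamma$ on $V(G)$ is faithful, transitive, amenable (there is a $\Gamma$-invariant finitely additive probability measure on all subsets of $V(G)$) and strongly amenable: its Schreier graph with respect to $A,B,C,D$ is infinite, connected, of bounded degree, and has an increasing sequence of finite vertex sets $\Omega_n$ with union $V(G)$ and $|\partial\Omega_n|/|\Omega_n|\to0$. Moreover the sets $V(G_n)$ form such a sequence in $G$, and they are a Følner sequence for $\Phi$: for every $\gamma\in\Gamma$, $|\Phi(\gamma)V(G_n)\cup V(G_n)|/|V(G_n)|\to1$. -/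

import Mathlib

open Filter Topology

/-! ### Properly edge-coloured graphs and the group `ℤ₂ * ℤ₂ * ℤ₂ * ℤ₂` -/

/-- The four colours. -/
inductive Color
  | A | B | C | D
  deriving DecidableEq

/-- A simple graph on `V` with a proper edge-colouring by `A, B, C, D`: `Adj c x y` says that `x`
and `y` are joined by an edge of colour `c`. Each edge has one colour, and the edges at a vertex
have different colours. -/
structure ColoredGraph (V : Type*) where
  Adj : Color → V → V → Prop
  symm : ∀ {c x y}, Adj c x y → Adj c y x
  loopless : ∀ {c x}, ¬ Adj c x x
  color_unique : ∀ {c d x y}, Adj c x y → Adj d x y → c = d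
  proper : ∀ {c x y z}, Adj c x y → Adj c x z → y = z

/-- The underlying simple graph. -/
def ColoredGraph.toSimple {V : Type*} (G : ColoredGraph V) : SimpleGraph V where
  Adj x y := ∃ c, G.Adj c x y
  symm := ⟨fun _ _ ⟨c, h⟩ => ⟨c, G.symm h⟩⟩
  loopless := ⟨fun _ ⟨_, h⟩ => G.loopless h⟩

/-- `e` is an isomorphism of edge-coloured graphs (given by their coloured adjacency). -/
def IsColorIso {V W : Type*} (R : Color → V → V → Prop) (S : Color → W → W → Prop)
    (e : V ≃ W) : Prop :=
  ∀ c x y, R c x y ↔ S c (e x) (e y)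

/-- The group `Γ = ℤ₂ * ℤ₂ * ℤ₂ * ℤ₂`, the free product of four cyclic groups of order two. -/
abbrev Gam : Type := Monoid.CoprodI (fun _ : Color => Multiplicative (ZMod 2))

/-- The generator of order two of `Γ` named by the colour `c`. -/
def gen (c : Color) : Gam :=
  Monoid.CoprodI.of (M := fun _ : Color => Multiplicative (ZMod 2)) (i := c)
    (Multiplicative.ofAdd (1 : ZMod 2))

open Classical in
/-- Move along the edge of colour `c` at `x`; stay at `x` if there is none. -/
noncomputable def ColoredGraph.move {V : Type*} (G : ColoredGraph V) (c : Color) (x : V) : V :=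
  if h : ∃ y, G.Adj c x y then h.choose else x

theorem ColoredGraph.move_of_adj {V : Type*} (G : ColoredGraph V) {c : Color} {x y : V}
    (h : G.Adj c x y) : G.move c x = y := by
  have h' : ∃ y, G.Adj c x y := ⟨y, h⟩
  rw [ColoredGraph.move, dif_pos h']
  exact G.proper h'.choose_spec h

theorem ColoredGraph.move_of_not {V : Type*} (G : ColoredGraph V) {c : Color} {x : V}
    (h : ¬ ∃ y, G.Adj c x y) : G.move c x = x := by
  rw [ColoredGraph.move, dif_neg h]

theorem ColoredGraph.move_involutive {V : Type*} (G : ColoredGraph V) (c : Color) :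
    Function.Involutive (G.move c) := by
  intro x
  by_cases h : ∃ y, G.Adj c x y
  · obtain ⟨y, hy⟩ := h
    rw [G.move_of_adj hy, G.move_of_adj (G.symm hy)]
  · rw [G.move_of_not h, G.move_of_not h]

/-- The homomorphism from the cyclic group of order two given by an involution. -/
def involutionHom {V : Type*} (f : V → V) (hf : Function.Involutive f) :
    Multiplicative (ZMod 2) →* Equiv.Perm V where
  toFun a := hf.toPerm f ^ (Multiplicative.toAdd a).val
  map_one' := by simp
  map_mul' a b := by
    have h2 : hf.toPerm f ^ 2 = 1 := by
      ext x
      simp [pow_two, hf x]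
    rw [toAdd_mul, ZMod.val_add, ← pow_add]
    conv_rhs => rw [← Nat.mod_add_div
      ((Multiplicative.toAdd a).val + (Multiplicative.toAdd b).val) 2]
    rw [pow_add, pow_mul, h2, one_pow, mul_one]

/-- The action of `Γ` on the vertices of a properly 4-coloured graph: the generator of colour `c`
moves along the edges of colour `c`, and fixes the vertices which have no such edge. -/
noncomputable def ColoredGraph.action {V : Type*} (G : ColoredGraph V) : Gam →* Equiv.Perm V :=
  Monoid.CoprodI.lift (fun c => involutionHom (G.move c) (G.move_involutive c))

theorem ColoredGraph.action_gen {V : Type*} (G : ColoredGraph V) (c : Color) (x : V) :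
    G.action (gen c) x = G.move c x := by
  simp [ColoredGraph.action, gen, involutionHom, ZMod.val_one]

/-! ### Amenability -/

/-- An action on `X` is amenable if there is an invariant finitely additive probability measure
on all subsets of `X`. -/
def AmenableAction {Λ X : Type*} [Group Λ] (Φ : Λ →* Equiv.Perm X) : Prop :=
  ∃ μ : Set X → ℝ, (∀ S, 0 ≤ μ S) ∧ μ Set.univ = 1 ∧
    (∀ S T, Disjoint S T → μ (S ∪ T) = μ S + μ T) ∧
    ∀ g S, μ (Φ g '' S) = μ S

/-- The vertices of `S` which have a neighbour outside `S`. -/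
def vertexBoundary {V : Type*} (G : SimpleGraph V) (S : Set V) : Set V :=
  {x ∈ S | ∃ y, y ∉ S ∧ G.Adj x y}

/-- An increasing and exhausting sequence of finite sets of vertices, with `|∂Ω n| / |Ω n| → 0`. -/
structure ExhaustingSmallBoundary {V : Type*} (G : SimpleGraph V) (Ω : ℕ → Set V) : Prop where
  finite : ∀ n, (Ω n).Finite
  mono : Monotone Ω
  exhausts : ⋃ n, Ω n = Set.univ
  boundary : Tendsto (fun n => ((vertexBoundary G (Ω n)).ncard : ℝ) / ((Ω n).ncard : ℝ))
    atTop (𝓝 0)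

/-- A strongly amenable graph: infinite, connected, of bounded degree, and with an increasing
exhausting sequence of finite sets whose relative boundaries tend to zero. -/
structure StronglyAmenable {V : Type*} (G : SimpleGraph V) : Prop where
  infinite : Infinite V
  connected : G.Connected
  bounded_degree : ∃ d : ℕ, ∀ x, (G.neighborSet x).Finite ∧ (G.neighborSet x).ncard ≤ d
  exists_seq : ∃ Ω : ℕ → Set V, ExhaustingSmallBoundary G Ω

/-- The Schreier graph (loops omitted) of an action of `Γ`, for the generators `A, B, C, D`. -/
def schreierGraph {X : Type*} (Φ : Gam →* Equiv.Perm X) : SimpleGraph X :=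
  SimpleGraph.fromRel (fun x y => ∃ c, x = Φ (gen c) y)

/-- A Følner sequence of finite sets for an action: `|Φ(g)Ω n ∪ Ω n| / |Ω n| → 1` for all `g`. -/
structure FolnerSequence {Λ X : Type*} [Group Λ] (Φ : Λ →* Equiv.Perm X) (Ω : ℕ → Set X) :
    Prop where
  finite : ∀ n, (Ω n).Finite
  tendsto : ∀ g, Tendsto (fun n => (((Φ g '' Ω n) ∪ Ω n).ncard : ℝ) / ((Ω n).ncard : ℝ))
    atTop (𝓝 1)

/-! ### The words of `Γ` in length-lexicographic order -/

/-- A word is reduced if no two consecutive letters agree. -/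
def Reduced (w : List Color) : Prop := w.IsChain (· ≠ ·)

/-- The reduced words of length `k`, in lexicographic order. -/
def redWords : ℕ → List (List Color)
  | 0 => [[]]
  | k + 1 => [Color.A, Color.B, Color.C, Color.D].flatMap fun c =>
      ((redWords k).filter fun w => w.head? ≠ some c).map fun w => c :: w

/-- The enumeration `A, B, C, D, AB, AC, AD, BA, …` of the nontrivial reduced words, starting with
`nthWord 1 = A` (and `nthWord 0` is the empty word). -/
def nthWord (n : ℕ) : List Color := ((List.range (n + 1)).flatMap redWords).getD n []

theorem reduced_of_mem_redWords {k : ℕ} {w : List Color} (h : w ∈ redWords k) : Reduced w := by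
  induction k generalizing w with
  | zero =>
    simp only [redWords, List.mem_singleton] at h
    subst h
    exact List.isChain_nil
  | succ k ih =>
    simp only [redWords, List.mem_flatMap, List.mem_map, List.mem_filter] at h
    obtain ⟨c, -, v, ⟨hv, hc⟩, rfl⟩ := h
    have hv' := ih hv
    cases v with
    | nil => exact List.isChain_singleton _
    | cons d v =>
      refine List.isChain_cons_cons.2 ⟨?_, hv'⟩
      rintro rfl
      simp at hc

theorem reduced_nthWord (n : ℕ) : Reduced (nthWord n) := by
  unfold nthWord
  rw [List.getD_eq_getElem?_getD]
  cases h : ((List.range (n + 1)).flatMap redWords)[n]? with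
  | none => exact List.isChain_nil
  | some w =>
    have := List.mem_of_getElem? h
    simp only [List.mem_flatMap] at this
    obtain ⟨k, -, hk⟩ := this
    exact reduced_of_mem_redWords hk

/-- The colours of the path attached for the word `w = w_k … w_1`, read from its root. The path is
attached by an edge of colour `D`. If `w_1 ≠ D` it is `y_0, y_1, …, y_k`, with colours
`w_1, …, w_k`; if `w_1 = D` it is `y_1, …, y_k`, with colours `w_2, …, w_k`. -/
def pathColors (w : List Color) : List Color :=
  if w.reverse.head? = some Color.D then w.reverse.tail else w.reverse

theorem reduced_reverse {w : List Color} (h : Reduced w) : Reduced w.reverse := by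
  unfold Reduced at *
  rw [List.isChain_reverse]
  exact h.imp fun _ _ hab => hab.symm

theorem reduced_pathColors {w : List Color} (h : Reduced w) : Reduced (pathColors w) := by
  have h' := reduced_reverse h
  unfold pathColors
  split_ifs
  · exact List.IsChain.tail h'
  · exact h'

theorem head_pathColors {w : List Color} (h : Reduced w) :
    (pathColors w).head? ≠ some Color.D := by
  have h' := reduced_reverse h
  unfold pathColors
  split_ifs with hD
  · cases hw : w.reverse with
    | nil => simp
    | cons a l =>
      rw [hw] at hD h'
      cases l with
      | nil => simp
      | cons b l =>
        have := (List.isChain_cons_cons.1 h').1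
        simp only [List.head?_cons, Option.some.injEq] at hD
        subst hD
        simpa using this.symm
  · exact hD

/-! ### Rooted pieces and gluing -/

/-- A 4-coloured graph with a distinguished vertex at which there is no edge of colour `D`. -/
structure Marked where
  V : Type
  graph : ColoredGraph V
  root : V
  root_free : ∀ y, ¬ graph.Adj Color.D root y

/-- Isomorphisms of 4-coloured graphs which respect the distinguished vertices. -/
structure MarkedIso (M M' : Marked) where
  toEquiv : M.V ≃ M'.V
  isColorIso : IsColorIso M.graph.Adj M'.graph.Adj toEquiv
  map_root : toEquiv M.root = M'.root

/-- The graph with a single vertex. -/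
def singleVertex : Marked where
  V := Unit
  graph :=
    { Adj := fun _ _ _ => False
      symm := fun h => h
      loopless := fun h => h
      color_unique := fun h => h.elim
      proper := fun h => h.elim }
  root := ()
  root_free := fun _ h => h

/-- The path with vertices `0, …, |u|` in which the edge from `i` to `i + 1` has the colour `u i`,
with the distinguished vertex `0`; the colours form a reduced word not starting with `D`. -/
def pathGraph (u : List Color) (hu : Reduced u) (hD : u.head? ≠ some Color.D) : Marked where
  V := Fin (u.length + 1)
  graph :=
    { Adj := fun c i j => (j.val = i.val + 1 ∧ u[i.val]? = some c) ∨
        (i.val = j.val + 1 ∧ u[j.val]? = some c)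
      symm := fun h => h.symm
      loopless := by
        intro c x h
        omega
      color_unique := by
        rintro c d x y (⟨h1, h2⟩ | ⟨h1, h2⟩) (⟨h3, h4⟩ | ⟨h3, h4⟩)
        · simpa [h2] using h4
        · omega
        · omega
        · simpa [h2] using h4
      proper := by
        have key : ∀ (i : ℕ) (c : Color), u[i]? = some c → u[i + 1]? = some c → False := by
          intro i c h1 h2
          obtain ⟨hi, h1'⟩ := List.getElem?_eq_some_iff.1 h1
          obtain ⟨hj, h2'⟩ := List.getElem?_eq_some_iff.1 h2
          exact (List.isChain_iff_getElem.1 hu i hj) (h1'.trans h2'.symm)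
        rintro c x y z (⟨h1, h2⟩ | ⟨h1, h2⟩) (⟨h3, h4⟩ | ⟨h3, h4⟩)
        · exact Fin.ext (h1.trans h3.symm)
        · rw [h3] at h2
          exact (key _ _ h4 h2).elim
        · rw [h1] at h4
          exact (key _ _ h2 h4).elim
        · exact Fin.ext (by omega) }
  root := 0
  root_free := by
    rintro y (⟨_, h⟩ | ⟨h, _⟩)
    · apply hD
      rw [List.head?_eq_getElem?]
      exact h
    · simp at h

/-- The coloured adjacency of the graph obtained from a graph `H` and pieces `M j` by joining the
distinguished vertex of `M j` to the vertex `pos j` of `H` by an edge of colour `D`. -/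
inductive GlueAdj {W J : Type} (H : ColoredGraph W) (pos : J → W) (M : J → Marked) :
    Color → (W ⊕ Σ j, (M j).V) → (W ⊕ Σ j, (M j).V) → Prop
  | base {c x y} : H.Adj c x y → GlueAdj H pos M c (Sum.inl x) (Sum.inl y)
  | piece {c} (j : J) {x y} : (M j).graph.Adj c x y →
      GlueAdj H pos M c (Sum.inr ⟨j, x⟩) (Sum.inr ⟨j, y⟩)
  | bridge (j : J) : GlueAdj H pos M Color.D (Sum.inl (pos j)) (Sum.inr ⟨j, (M j).root⟩)
  | bridge' (j : J) : GlueAdj H pos M Color.D (Sum.inr ⟨j, (M j).root⟩) (Sum.inl (pos j))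

/-- The glued graph, with a distinguished vertex `r` of `H` to which no piece is attached. The
graph `H` has no edges of colour `D` and pieces are attached to it at distinct vertices. -/
def glue {W J : Type} (H : ColoredGraph W) (hH : ∀ x y, ¬ H.Adj Color.D x y) (pos : J → W)
    (hpos : Function.Injective pos) (M : J → Marked) (r : W) (hr : ∀ j, pos j ≠ r) : Marked where
  V := W ⊕ Σ j, (M j).V
  graph :=
    { Adj := GlueAdj H pos M
      symm := by
        intro c x y h
        cases h with
        | base h => exact .base (H.symm h)
        | piece j h => exact .piece j ((M j).graph.symm h)
        | bridge j => exact .bridge' j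
        | bridge' j => exact .bridge j
      loopless := by
        intro c x h
        cases h with
        | base h => exact H.loopless h
        | piece j h => exact (M j).graph.loopless h
      color_unique := by
        intro c d x y h h'
        cases h with
        | base h => cases h' with
          | base h' => exact H.color_unique h h'
        | piece j h => cases h' with
          | piece _ h' => exact (M j).graph.color_unique h h'
        | bridge j =>
          generalize hx : (Sum.inl (pos j) : W ⊕ Σ j, (M j).V) = x at h'
          cases h' <;> first | rfl | cases hx
        | bridge' j =>
          generalize hx : (Sum.inl (pos j) : W ⊕ Σ j, (M j).V) = x at h'
          cases h' <;> first | rfl | cases hx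
      proper := by
        intro c x y z h h'
        cases h with
        | base h => 
          rename_i x y
          generalize hx : (Sum.inl x : W ⊕ Σ j, (M j).V) = x' at h'
          cases h' with
          | base h' => cases hx; rw [H.proper h h']
          | piece => cases hx
          | bridge => exact (hH _ _ h).elim
          | bridge' => cases hx
        | piece j h => cases h' with
          | piece _ h' => rw [(M j).graph.proper h h']
          | bridge' => exact ((M j).root_free _ h).elim
        | bridge j =>
          generalize hx : (Sum.inl (pos j) : W ⊕ Σ j, (M j).V) = x at h'
          cases h' with
          | base h' => exact (hH _ _ h').elim
          | piece => cases hx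
          | bridge k =>
            have := hpos (Sum.inl.inj hx)
            subst this
            rfl
          | bridge' => cases hx
        | bridge' j =>
          generalize hx : (Sum.inr ⟨j, (M j).root⟩ : W ⊕ Σ j, (M j).V) = x at h'
          cases h' with
          | base => cases hx
          | piece k h' => 
            cases hx
            exact ((M j).root_free _ h').elim
          | bridge => cases hx
          | bridge' k =>
            cases hx
            rfl }
  root := Sum.inl r
  root_free := by
    intro y h
    generalize hx : (Sum.inl r : W ⊕ Σ j, (M j).V) = x at h
    cases h with
    | base h => exact hH _ _ h
    | piece => cases hx
    | bridge j => exact hr j (Sum.inl.inj hx).symm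
    | bridge' => cases hx

/-! ### The auxiliary graphs -/

/-- The subgroup of `Γ` generated by `A, B, C`. -/
def GamT : Subgroup Gam := Subgroup.closure {gen Color.A, gen Color.B, gen Color.C}

theorem gen_mem_GamT {c : Color} (h : c ≠ Color.D) : gen c ∈ GamT := by
  apply Subgroup.subset_closure
  cases c <;> simp at h ⊢

/-- Coloured adjacency in the Cayley graph of the quotient of `⟨A, B, C⟩` by `N`: the cosets of `g`
and `g * c` are joined by an edge of colour `c`, for `c = A, B, C`. -/
def cayleyAdj (N : Subgroup GamT) (c : Color) (x y : GamT ⧸ N) : Prop :=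
  ∃ (h : c ≠ Color.D) (g : GamT), x = QuotientGroup.mk g ∧
    y = QuotientGroup.mk (g * ⟨gen c, gen_mem_GamT h⟩)

/-- Coloured adjacency in the cycle `0, 1, …, 2i - 1` of length `2i`, whose edges are coloured by
`A` and `B` alternatingly, beginning with the edge from `0` to `1`, of colour `A`. -/
def cycleAdj (i : ℕ) : Color → Fin (2 * i) → Fin (2 * i) → Prop
  | Color.A, x, y => ∃ k : ℕ, (x.val = 2 * k ∧ y.val = 2 * k + 1) ∨
      (y.val = 2 * k ∧ x.val = 2 * k + 1)
  | Color.B, x, y => ∃ k : ℕ, (x.val = 2 * k + 1 ∧ y.val = (2 * k + 2) % (2 * i)) ∨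
      (y.val = 2 * k + 1 ∧ x.val = (2 * k + 2) % (2 * i))
  | _, _, _ => False

/-- The triangle with edges of colours `A, B, C`. -/
def triangle : ColoredGraph (Fin 3) where
  Adj c x y := x ≠ y ∧ (match c with
    | Color.A => x ≠ 2 ∧ y ≠ 2
    | Color.B => x ≠ 0 ∧ y ≠ 0
    | Color.C => x ≠ 1 ∧ y ≠ 1
    | Color.D => False)
  symm := by
    intro c x y h
    cases c <;> simp_all [eq_comm]
  loopless := fun h => h.1 rfl
  color_unique := by
    intro c d x y
    cases c <;> cases d <;> simp <;> omega
  proper := by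
    intro c x y z
    cases c <;> simp <;> omega

/-! ### The construction -/

/-- The first graph: the vertex `q` of the triangle is joined to the root of the piece `M` by an
edge of colour `D`, and the vertex `r ≠ q` of the triangle is distinguished. -/
def firstStep (M : Marked) (q r : Fin 3) (hqr : q ≠ r) : Marked :=
  glue triangle (fun _ _ h => h.2) (fun _ : Unit => q) (fun _ _ _ => rfl) (fun _ => M) r
    (fun _ => hqr)

/-- The scales `s i = m ^ i * 2 ^ |V(G_{i-1})|`, for `i ≥ 1`. -/
noncomputable def scale (m : ℕ) (G : ℕ → Marked) (i : ℕ) : ℕ :=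
  m ^ i * 2 ^ Nat.card (G (i - 1)).V

/-- The choices made in step `n ≥ 2`, where `G 0, …, G (n - 1)` are the graphs already constructed
and `N` is the chosen chain of subgroups. -/
structure StepChoice (m : ℕ) (N : ℕ → Subgroup GamT) (G : ℕ → Marked) (n : ℕ) where
  /-- the vertices of the graph `H_n` -/
  W : Type
  /-- the graph `H_n` -/
  H : ColoredGraph W
  shape_even : Even n → ∃ (i : ℕ) (e : W ≃ Fin (2 * i)), IsColorIso H.Adj (cycleAdj i) e
  shape_odd : Odd n → ∃ (i : ℕ) (e : W ≃ GamT ⧸ N i), IsColorIso H.Adj (cayleyAdj (N i)) e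
  diam_ge : 10 * scale m G n ≤ H.toSimple.diam
  /-- The partition of the vertices of `H_n` into `R_1, …, R_{n+1}`: `x` lies in `R_(cls x)`. -/
  cls : W → ℕ
  cls_mem : ∀ x, cls x ∈ Finset.Icc 1 (n + 1)
  net : ∀ i ∈ Finset.Icc 1 n, ∀ x y, x ≠ y → cls x = i → cls y = i →
    2 * scale m G i ≤ H.toSimple.dist x y
  cover : ∀ i ∈ Finset.Icc 1 n, ∀ x, ∃ p, cls p = i ∧ H.toSimple.dist p x ≤ 10 * scale m G i
  /-- the vertex of `R_n` to which the copy of `G_{n-1}` is attached -/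
  z : W
  cls_z : cls z = n
  /-- the vertex of `R_{n+1}` to which the path is attached -/
  x : W
  cls_x : cls x = n + 1
  /-- the vertex `r_n` -/
  r : W
  cls_r : cls r = n + 1
  r_ne_x : r ≠ x

namespace StepChoice

variable {m : ℕ} {N : ℕ → Subgroup GamT} {G : ℕ → Marked} {n : ℕ} (S : StepChoice m N G n)

theorem no_D (x y : S.W) : ¬ S.H.Adj Color.D x y := by
  intro h
  rcases Nat.even_or_odd n with hn | hn
  · obtain ⟨i, e, he⟩ := S.shape_even hn
    exact (he _ _ _).1 h
  · obtain ⟨i, e, he⟩ := S.shape_odd hn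
    obtain ⟨h', -⟩ := (he _ _ _).1 h
    exact h' rfl

/-- The pieces attached in step `n`: one for each vertex of `R_1, …, R_{n-1}`, the copy of
`G_{n-1}`, and the path. -/
abbrev Site : Type := {h : S.W // S.cls h < n} ⊕ (Unit ⊕ Unit)

/-- The vertices of `H_n` to which the pieces are attached. -/
def pos : S.Site → S.W
  | Sum.inl h => h.1
  | Sum.inr (Sum.inl _) => S.z
  | Sum.inr (Sum.inr _) => S.x

/-- The pieces: a copy of `G_{i-1}` for each vertex of `R_i`, `1 ≤ i ≤ n - 1`; a copy of `G_{n-1}`;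
and the path of the word with number `n - 1`. -/
def part : S.Site → Marked
  | Sum.inl h => G (S.cls h.1 - 1)
  | Sum.inr (Sum.inl _) => G (n - 1)
  | Sum.inr (Sum.inr _) => pathGraph (pathColors (nthWord (n - 1)))
      (reduced_pathColors (reduced_nthWord _)) (head_pathColors (reduced_nthWord _))

theorem pos_injective : Function.Injective S.pos := by
  have hz := S.cls_z
  have hx := S.cls_x
  rintro (⟨a, ha⟩ | ⟨⟨⟩⟩ | ⟨⟨⟩⟩) (⟨b, hb⟩ | ⟨⟨⟩⟩ | ⟨⟨⟩⟩) h <;> simp only [pos] at h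
  · subst h; rfl
  · subst h; omega
  · subst h; omega
  · subst h; omega
  · rfl
  · rw [h] at hz; omega
  · subst h; omega
  · rw [h] at hx; omega
  · rfl

theorem pos_ne_r (j : S.Site) : S.pos j ≠ S.r := by
  have hr := S.cls_r
  have hz := S.cls_z
  rcases j with ⟨a, ha⟩ | ⟨⟨⟩⟩ | ⟨⟨⟩⟩ <;> simp only [pos]
  · rintro rfl; omega
  · intro h; rw [h] at hz; omega
  · exact S.r_ne_x.symm

/-- The graph `G_n` produced in step `n`, with the distinguished vertex `r_n`. -/
def result : Marked := glue S.H S.no_D S.pos S.pos_injective S.part S.r S.pos_ne_r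

end StepChoice

/-- A run of the construction with parameter `m`: the sequence of the graphs `G_n` (with the
distinguished vertices `r_n`), for some sequence of choices. -/
structure Construction (m : ℕ) where
  /-- the chain of subgroups of finite index with trivial intersection -/
  N : ℕ → Subgroup GamT
  normal : ∀ i, (N i).Normal
  finiteIndex : ∀ i, (N i).FiniteIndex
  antitone : Antitone N
  iInf_eq_bot : ⨅ i, N i = ⊥
  /-- the graphs `G_n` -/
  G : ℕ → Marked
  zero : MarkedIso (G 0) singleVertex
  /-- the vertices `q` and `r_1` of the triangle -/
  q : Fin 3
  r₁ : Fin 3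
  q_ne_r₁ : q ≠ r₁
  one : MarkedIso (G 1) (firstStep (G 0) q r₁ q_ne_r₁)
  /-- the choices made in the steps `2, 3, …` -/
  choice : ∀ n, StepChoice m N G (n + 2)
  step : ∀ n, MarkedIso (G (n + 2)) (choice n).result

namespace Construction

variable {m : ℕ} (K : Construction m)

/-- The inclusion of `G_n` in `G_{n+1}`, as the copy of `G_n` attached in step `n + 1`. -/
def incl : ∀ n, (K.G n).V → (K.G (n + 1)).V
  | 0 => fun x => K.one.toEquiv.symm (Sum.inr ⟨(), x⟩)
  | n + 1 => fun x => (K.step n).toEquiv.symm (Sum.inr ⟨Sum.inr (Sum.inl ()), x⟩)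

theorem glueAdj_inr {W J : Type} {H : ColoredGraph W} {pos : J → W} {M : J → Marked} {c : Color}
    (j : J) (x y : (M j).V) :
    GlueAdj H pos M c (Sum.inr ⟨j, x⟩) (Sum.inr ⟨j, y⟩) ↔ (M j).graph.Adj c x y := by
  constructor
  · intro h
    cases h with
    | piece _ h => exact h
  · exact fun h => .piece j h

theorem incl_injective (n : ℕ) : Function.Injective (K.incl n) := by
  intro x y h
  cases n with
  | zero =>
    have h1 := K.one.toEquiv.symm.injective h
    have h2 := Sum.inr.inj h1
    exact eq_of_heq (Sigma.mk.inj h2).2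
  | succ n =>
    have h1 := (K.step n).toEquiv.symm.injective h
    have h2 := Sum.inr.inj h1
    exact eq_of_heq (Sigma.mk.inj h2).2

theorem incl_adj (n : ℕ) (c : Color) (x y : (K.G n).V) :
    (K.G (n + 1)).graph.Adj c (K.incl n x) (K.incl n y) ↔ (K.G n).graph.Adj c x y := by
  cases n with
  | zero =>
    rw [K.one.isColorIso]
    unfold incl
    erw [Equiv.apply_symm_apply, Equiv.apply_symm_apply]
    exact glueAdj_inr (M := fun _ : Unit => K.G 0) () x y
  | succ n =>
    rw [(K.step n).isColorIso]
    unfold incl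
    erw [Equiv.apply_symm_apply, Equiv.apply_symm_apply]
    exact glueAdj_inr (M := (K.choice n).part) (Sum.inr (Sum.inl ())) x y

/-- The inclusion of `G_i` in `G_j`, for `i ≤ j`. -/
def inclLE (i j : ℕ) (h : i ≤ j) : (K.G i).V ↪ (K.G j).V :=
  ⟨Nat.leRecOn (C := fun n => (K.G n).V) h (fun {n} => K.incl n),
    Nat.leRecOn_injective h (fun {n} => K.incl n) K.incl_injective⟩

instance directedSystem : DirectedSystem (fun n => (K.G n).V) (fun i j h => K.inclLE i j h) where
  map_self _ x := Nat.leRecOn_self (C := fun n => (K.G n).V) x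
  map_map _ _ _ hij hjk x := (Nat.leRecOn_trans (C := fun n => (K.G n).V) hij hjk x).symm

theorem inclLE_adj (i j : ℕ) (h : i ≤ j) (c : Color) (x y : (K.G i).V) :
    (K.G j).graph.Adj c (K.inclLE i j h x) (K.inclLE i j h y) ↔ (K.G i).graph.Adj c x y := by
  induction j, h using Nat.le_induction with
  | base =>
    rw [DirectedSystem.map_self' (fun i j h => K.inclLE i j h),
      DirectedSystem.map_self' (fun i j h => K.inclLE i j h)]
  | succ j h ih =>
    rw [← ih, ← K.incl_adj j]
    have : ∀ x, K.inclLE i (j + 1) (Nat.le_succ_of_le h) x = K.incl j (K.inclLE i j h x) :=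
      fun x => Nat.leRecOn_succ (C := fun n => (K.G n).V) h x
    rw [← this, ← this]

/-- The vertices of the union of the graphs `G_n`. -/
abbrev Vertex : Type := DirectLimit (fun n => (K.G n).V) (fun i j h => K.inclLE i j h)

/-- The vertex of the union given by a vertex of `G_n`. -/
def toVertex (n : ℕ) (x : (K.G n).V) : K.Vertex := Quotient.mk _ ⟨n, x⟩

theorem toVertex_injective (n : ℕ) : Function.Injective (K.toVertex n) :=
  DirectLimit.mk_injective (fun i j h => K.inclLE i j h) (fun i j h => (K.inclLE i j h).injective) n

theorem toVertex_inclLE (i j : ℕ) (h : i ≤ j) (x : (K.G i).V) :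
    K.toVertex j (K.inclLE i j h x) = K.toVertex i x :=
  DirectLimit.mk_apply (F := fun n => (K.G n).V) (f := fun i j h => K.inclLE i j h) i j x h

/-- Coloured adjacency in the union. -/
def limitAdj (c : Color) (a b : K.Vertex) : Prop :=
  ∃ n x y, (K.G n).graph.Adj c x y ∧ K.toVertex n x = a ∧ K.toVertex n y = b

theorem limitAdj_iff {n : ℕ} {c : Color} {x y : (K.G n).V} :
    K.limitAdj c (K.toVertex n x) (K.toVertex n y) ↔ (K.G n).graph.Adj c x y := by
  constructor
  · rintro ⟨k, x', y', h, hx, hy⟩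
    rw [← K.inclLE_adj k (max k n) (le_max_left _ _)] at h
    rw [← K.toVertex_inclLE k (max k n) (le_max_left _ _),
      ← K.toVertex_inclLE n (max k n) (le_max_right _ _)] at hx hy
    rw [K.toVertex_injective _ hx, K.toVertex_injective _ hy, K.inclLE_adj] at h
    exact h
  · exact fun h => ⟨n, x, y, h, rfl, rfl⟩

/-- The 4-coloured graph `G`, the union of the increasing sequence `G_0 ⊂ G_1 ⊂ G_2 ⊂ …`. -/
def graph : ColoredGraph K.Vertex where
  Adj := K.limitAdj
  symm := fun ⟨n, x, y, h, hx, hy⟩ => ⟨n, y, x, (K.G n).graph.symm h, hy, hx⟩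
  loopless := by
    intro c a h
    obtain ⟨n, x, rfl⟩ := DirectLimit.exists_eq_mk (fun i j h => K.inclLE i j h) a
    exact (K.G n).graph.loopless (K.limitAdj_iff.1 h)
  color_unique := by
    intro c d a b h h'
    obtain ⟨n, x, y, rfl, rfl⟩ := DirectLimit.exists_eq_mk₂ (fun i j h => K.inclLE i j h) a b
    exact (K.G n).graph.color_unique (K.limitAdj_iff.1 h) (K.limitAdj_iff.1 h')
  proper := by
    intro c a b b' h h'
    obtain ⟨n, x, y, z, rfl, rfl, rfl⟩ :=
      DirectLimit.exists_eq_mk₃ (fun i j h => K.inclLE i j h) a b b'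
    rw [(K.G n).graph.proper (K.limitAdj_iff.1 h) (K.limitAdj_iff.1 h')]

/-- The set of vertices of the subgraph `G_n` of `G`. -/
def subgraphSet (n : ℕ) : Set K.Vertex := Set.range (K.toVertex n)

end Construction

/-! The amenability statements rest on one fact: `r_n` is the only vertex of `G_n` with a neighbor
outside `G_n` in the union. The copy of `G_n` inside `G_{n+1}` is attached by a single edge at
`r_n`. Any edge leaving a later `G_j` starts at `r_j`, which lies in the new part of `G_j` and not
in `G_{j-1}` (`mem_range_inclLE_or_eq_root`, `eq_root_of_adj`). Each step adds at least the new
root, so `|V(G_n)| > n` and the relative boundary tends to zero. A word with `k` letters pushes at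
most `k` vertices out of `V(G_n)` (`ncard_action_image_diff_le`), which gives the Følner property;
an ultrafilter limit of relative sizes is then an invariant mean (`amenableAction_of_tendsto`).

Transitivity is connectedness, by induction over the gluing steps. For faithfulness, every
nontrivial element is a nonempty reduced word, and its path is attached in some step. Walking along
that path moves its starting vertex, namely `x_n` or `y_0`, to its other end
(`action_wordElt_ne_one`).

Existence needs graphs `H_n` of large diameter and partitions of them into nets. The cycle of length
`2i` has diameter at least `i`. The same word paths show that `⟨A, B, C⟩` is residually finite: the
joint kernels of its actions on the first paths form a chain with trivial intersection. Since the
group is infinite, Cayley graphs of quotients along any such chain have arbitrarily large diameter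
(`exists_cayleyGraph`).

The nets are chosen greedily (`exists_net_partition`): `R_i` is a maximal `2 s_i`-separated set
among the vertices not yet used. Because `s_i ≥ 2^i`, a counting along paths shows that the earlier
nets leave two free vertices close to every vertex (`exists_two_unassigned`). Hence a maximal
separated set of free vertices is a net for the whole graph, and two vertices remain at the end for
`x_n` and `r_n`. -/

/-! ### Words and group elements -/

/-- The element of `Γ` given by a word. -/
def wordElt (w : List Color) : Gam := (w.map gen).prod

theorem wordElt_cons (c : Color) (w : List Color) : wordElt (c :: w) = gen c * wordElt w := by
  simp [wordElt]

theorem wordElt_append (v w : List Color) : wordElt (v ++ w) = wordElt v * wordElt w := by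
  simp [wordElt]

theorem gen_mul_self (c : Color) : gen c * gen c = 1 := by
  unfold gen
  rw [← map_mul, ← ofAdd_add]
  have : (1 + 1 : ZMod 2) = 0 := by decide
  rw [this, ofAdd_zero, map_one]

theorem gen_inv (c : Color) : (gen c)⁻¹ = gen c :=
  inv_eq_of_mul_eq_one_left (gen_mul_self c)

theorem closure_range_gen : Subgroup.closure (Set.range gen) = ⊤ := by
  rw [eq_top_iff]
  rintro g -
  induction g using Monoid.CoprodI.induction_on with
  | one => exact one_mem _
  | of i a =>
    have h : a = 1 ∨ a = Multiplicative.ofAdd (1 : ZMod 2) := by revert a; decide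
    rcases h with rfl | rfl
    · rw [map_one]
      exact one_mem _
    · exact Subgroup.subset_closure ⟨i, rfl⟩
  | mul x y hx hy => exact mul_mem hx hy

/-- Multiplying a reduced word on the left by a generator either cancels its first letter or
prepends a letter. The set `s` allows the same argument to serve all of `Γ` and the subgroup `⟨A, B,
C⟩`. -/
theorem exists_reduced_word {s : Set Color} {g : Gam} (hg : g ∈ Subgroup.closure (gen '' s)) :
    ∃ w, Reduced w ∧ (∀ c ∈ w, c ∈ s) ∧ wordElt w = g := by
  have key : ∀ c ∈ s, ∀ y : Gam, (∃ w, Reduced w ∧ (∀ c ∈ w, c ∈ s) ∧ wordElt w = y) →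
      ∃ w, Reduced w ∧ (∀ c ∈ w, c ∈ s) ∧ wordElt w = gen c * y := by
    rintro c hc y ⟨w, hw, hws, rfl⟩
    by_cases h : w.head? = some c
    · obtain ⟨v, rfl⟩ : ∃ v, w = c :: v := by
        cases w with
        | nil => simp at h
        | cons d v => exact ⟨v, by simpa using h⟩
      refine ⟨v, List.IsChain.tail hw, fun d hd => hws d (List.mem_cons_of_mem _ hd), ?_⟩
      rw [wordElt_cons, ← mul_assoc, gen_mul_self, one_mul]
    · refine ⟨c :: w, ?_, ?_, wordElt_cons _ _⟩
      · cases w with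
        | nil => exact List.isChain_singleton _
        | cons d v => exact List.isChain_cons_cons.2 ⟨fun e => h (by simp [e]), hw⟩
      · intro d hd
        rcases List.mem_cons.1 hd with rfl | hd
        · exact hc
        · exact hws d hd
  induction hg using Subgroup.closure_induction_left with
  | one => exact ⟨[], List.isChain_nil, by simp, rfl⟩
  | mul_left x hx y _ ih =>
    obtain ⟨c, hc, rfl⟩ := hx
    exact key c hc y ih
  | inv_mul_cancel x hx y _ ih =>
    obtain ⟨c, hc, rfl⟩ := hx
    rw [gen_inv]
    exact key c hc y ih

theorem exists_reduced_word_ne_nil {g : Gam} (hg : g ≠ 1) :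
    ∃ w, Reduced w ∧ w ≠ [] ∧ wordElt w = g := by
  obtain ⟨w, hw, -, rfl⟩ := exists_reduced_word (s := Set.univ) (g := g)
    (by rw [Set.image_univ, closure_range_gen]; trivial)
  exact ⟨w, hw, by rintro rfl; exact hg rfl, rfl⟩

theorem mem_GamT_iff_closure {g : Gam} :
    g ∈ GamT ↔ g ∈ Subgroup.closure (gen '' {c | c ≠ Color.D}) := by
  have : gen '' {c | c ≠ Color.D} = {gen Color.A, gen Color.B, gen Color.C} := by
    ext x
    constructor
    · rintro ⟨c, hc, rfl⟩
      cases c <;> simp at hc ⊢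
    · rintro (rfl | rfl | rfl)
      exacts [⟨_, by simp, rfl⟩, ⟨_, by simp, rfl⟩, ⟨_, by simp, rfl⟩]
  rw [this, GamT]

theorem exists_reduced_word_GamT {g : Gam} (hg : g ∈ GamT) :
    ∃ w, Reduced w ∧ (∀ c ∈ w, c ≠ Color.D) ∧ wordElt w = g :=
  exists_reduced_word (mem_GamT_iff_closure.1 hg)

theorem wordElt_mem_GamT {w : List Color} (hw : ∀ c ∈ w, c ≠ Color.D) : wordElt w ∈ GamT := by
  induction w with
  | nil => exact one_mem _
  | cons c w ih =>
    rw [wordElt_cons]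
    exact mul_mem (gen_mem_GamT (hw c (by simp))) (ih fun d hd => hw d (by simp [hd]))

/-- A word acts by walking along the edges coloured by its letters, from the last to the first. -/
theorem ColoredGraph.action_wordElt_reverse {V : Type*} (G : ColoredGraph V) (u : List Color)
    (f : ℕ → V) (hf : ∀ i c, u[i]? = some c → G.Adj c (f i) (f (i + 1))) :
    G.action (wordElt u.reverse) (f 0) = f u.length := by
  induction u using List.reverseRecOn with
  | nil => simp [wordElt]
  | append_singleton u c ih =>
    have hc := hf u.length c (by simp)
    have ih' := ih fun i d hd => hf i d (by
      rw [List.getElem?_append_left (List.getElem?_eq_some_iff.1 hd).1]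
      exact hd)
    rw [List.reverse_append, List.reverse_singleton, List.singleton_append, wordElt_cons, map_mul,
      Equiv.Perm.mul_apply, ih', G.action_gen, G.move_of_adj hc]
    simp

theorem pathGraph_adj_succ {u : List Color} {hu : Reduced u} {hD : u.head? ≠ some Color.D}
    {i : ℕ} {c : Color} (h : u[i]? = some c) :
    (pathGraph u hu hD).graph.Adj c (Fin.ofNat (u.length + 1) i)
      (Fin.ofNat (u.length + 1) (i + 1)) := by
  have hi := (List.getElem?_eq_some_iff.1 h).1
  left
  simp only [Fin.ofNat]
  rw [Nat.mod_eq_of_lt (by omega), Nat.mod_eq_of_lt (by omega)]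
  exact ⟨rfl, h⟩

/-! ### The enumeration of reduced words -/

theorem mem_redWords {w : List Color} (hw : Reduced w) : w ∈ redWords w.length := by
  induction w with
  | nil => simp [redWords]
  | cons c w ih =>
    simp only [List.length_cons, redWords, List.mem_flatMap, List.mem_map, List.mem_filter]
    refine ⟨c, by cases c <;> simp, w, ⟨ih (List.IsChain.tail hw), ?_⟩, rfl⟩
    cases w with
    | nil => simp
    | cons d w => simpa using (List.isChain_cons_cons.1 hw).1.symm

theorem flatMap_range_prefix (f : ℕ → List (List Color)) {a b : ℕ} (h : a ≤ b) :
    (List.range a).flatMap f <+: (List.range b).flatMap f := by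
  induction b, h using Nat.le_induction with
  | base => exact List.prefix_rfl
  | succ b _ ih =>
    rw [List.range_succ, List.flatMap_append]
    exact ih.trans (List.prefix_append _ _)

theorem exists_reduced_of_length (k : ℕ) : ∃ w, Reduced w ∧ w.length = k ∧
    (∀ c ∈ w, c = Color.A ∨ c = Color.B) := by
  induction k with
  | zero => exact ⟨[], List.isChain_nil, rfl, by simp⟩
  | succ k ih =>
    obtain ⟨w, hw, hk, hc⟩ := ih
    cases w with
    | nil => exact ⟨[Color.A], List.isChain_singleton _, by simp at hk ⊢; omega, by simp⟩
    | cons d v =>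
      rcases hc d (by simp) with rfl | rfl
      · refine ⟨Color.B :: Color.A :: v, List.isChain_cons_cons.2 ⟨by simp, hw⟩, by simp [← hk], ?_⟩
        intro c h
        rcases List.mem_cons.1 h with rfl | h
        · simp
        · exact hc c h
      · refine ⟨Color.A :: Color.B :: v, List.isChain_cons_cons.2 ⟨by simp, hw⟩, by simp [← hk], ?_⟩
        intro c h
        rcases List.mem_cons.1 h with rfl | h
        · simp
        · exact hc c h

/-- There is a reduced word of every length, so each block contributes at least one entry. Position
`n` therefore exists in the list read by `nthWord n`, and its default value never interferes. -/
theorem le_length_flatMap_redWords (a : ℕ) : a ≤ ((List.range a).flatMap redWords).length := by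
  induction a with
  | zero => simp
  | succ a ih =>
    rw [List.range_succ, List.flatMap_append, List.length_append, List.flatMap_singleton]
    obtain ⟨w, hw, rfl, -⟩ := exists_reduced_of_length a
    have := List.length_pos_of_mem (mem_redWords hw)
    omega

theorem nthWord_zero : nthWord 0 = [] := rfl

theorem exists_nthWord_eq {w : List Color} (hw : Reduced w) : ∃ n, nthWord n = w := by
  have hmem : w ∈ (List.range (w.length + 1)).flatMap redWords :=
    List.mem_flatMap.2 ⟨w.length, by simp, mem_redWords hw⟩
  obtain ⟨p, hp⟩ := List.mem_iff_getElem?.1 hmem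
  refine ⟨p, ?_⟩
  have hlen := le_length_flatMap_redWords (p + 1)
  unfold nthWord
  rw [List.getD_eq_getElem?_getD]
  suffices h : ((List.range (p + 1)).flatMap redWords)[p]? = some w by simp [h]
  -- The list known to contain `w` and the list read by `nthWord p` are prefixes of one another, in
  -- one order or the other, so they agree at position `p`.
  rcases le_total (w.length + 1) (p + 1) with h | h
  · obtain ⟨t, ht⟩ := flatMap_range_prefix redWords h
    rw [← ht, List.getElem?_append_left (List.getElem?_eq_some_iff.1 hp).1, hp]
  · obtain ⟨t, ht⟩ := flatMap_range_prefix redWords h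
    rw [← ht, List.getElem?_append_left (by omega)] at hp
    exact hp

theorem exists_nthWord_succ_eq {w : List Color} (hw : Reduced w) (h : w ≠ []) :
    ∃ n, nthWord (n + 1) = w := by
  obtain ⟨n, hn⟩ := exists_nthWord_eq hw
  cases n with
  | zero => exact (h (hn.symm.trans nthWord_zero)).elim
  | succ n => exact ⟨n, hn⟩

/-! ### Connectedness and finiteness of the graphs of the construction -/

theorem MarkedIso.connected {M M' : Marked} (e : MarkedIso M M')
    (h : M'.graph.toSimple.Connected) : M.graph.toSimple.Connected := by
  let f : M.graph.toSimple ≃g M'.graph.toSimple :=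
    { toEquiv := e.toEquiv
      map_rel_iff' := by
        intro x y
        exact exists_congr fun c => (e.isColorIso c x y).symm }
  exact f.connected_iff.2 h

theorem connected_singleVertex : singleVertex.graph.toSimple.Connected where
  preconnected := fun _ _ => SimpleGraph.Reachable.refl _
  nonempty := ⟨()⟩

theorem connected_pathGraph (u : List Color) (hu : Reduced u) (hD : u.head? ≠ some Color.D) :
    (pathGraph u hu hD).graph.toSimple.Connected := by
  refine SimpleGraph.connected_iff_exists_forall_reachable _ |>.2 ⟨(0 : Fin (u.length + 1)), ?_⟩
  rintro ⟨i, hi⟩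
  induction i with
  | zero => exact SimpleGraph.Reachable.refl _
  | succ i ih =>
    refine (ih (by omega)).trans (SimpleGraph.Adj.reachable ?_)
    exact ⟨u[i]'(by omega), Or.inl ⟨rfl, List.getElem?_eq_getElem _⟩⟩

theorem connected_triangle : triangle.toSimple.Connected := by
  refine SimpleGraph.connected_iff_exists_forall_reachable _ |>.2 ⟨0, ?_⟩
  intro i
  fin_cases i
  · exact SimpleGraph.Reachable.refl _
  · exact SimpleGraph.Adj.reachable ⟨Color.A, by simp [triangle]⟩
  · exact SimpleGraph.Adj.reachable ⟨Color.C, by simp [triangle]⟩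

theorem connected_glue {W J : Type} (H : ColoredGraph W) (hH : ∀ x y, ¬ H.Adj Color.D x y)
    (pos : J → W) (hpos : Function.Injective pos) (M : J → Marked) (r : W) (hr : ∀ j, pos j ≠ r)
    (hconn : H.toSimple.Connected) (hM : ∀ j, (M j).graph.toSimple.Connected) :
    (glue H hH pos hpos M r hr).graph.toSimple.Connected := by
  let fH : H.toSimple →g (glue H hH pos hpos M r hr).graph.toSimple :=
    { toFun := Sum.inl
      map_rel' := fun ⟨c, h⟩ => ⟨c, GlueAdj.base h⟩ }
  let fM : ∀ j, (M j).graph.toSimple →g (glue H hH pos hpos M r hr).graph.toSimple := fun j =>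
    { toFun := fun x => Sum.inr ⟨j, x⟩
      map_rel' := fun ⟨c, h⟩ => ⟨c, GlueAdj.piece j h⟩ }
  refine SimpleGraph.connected_iff_exists_forall_reachable _ |>.2 ⟨Sum.inl r, ?_⟩
  have hl : ∀ x, (glue H hH pos hpos M r hr).graph.toSimple.Reachable (Sum.inl r) (Sum.inl x) :=
    fun x => (hconn.preconnected r x).map fH
  rintro (x | ⟨j, x⟩)
  · exact hl x
  · refine ((hl (pos j)).trans (SimpleGraph.Adj.reachable ?_)).trans
      (((hM j).preconnected (M j).root x).map (fM j))
    exact ⟨Color.D, GlueAdj.bridge j⟩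

namespace StepChoice

variable {m : ℕ} {N : ℕ → Subgroup GamT} {G : ℕ → Marked} {n : ℕ} (S : StepChoice m N G n)

/-- The diameter of a disconnected graph is `0` by convention, so the lower bound on the diameter
already forces connectedness. -/
theorem connected_H (hm : 0 < m) : S.H.toSimple.Connected := by
  have := S.diam_ge
  have hs : 0 < scale m G n := by unfold scale; positivity
  have : Nonempty S.W := ⟨S.r⟩
  exact SimpleGraph.connected_of_ediam_ne_top
    (SimpleGraph.ediam_ne_top_of_diam_ne_zero (by omega))

theorem part_property {P : Marked → Prop} (hn : 0 < n) (hG : ∀ i < n, P (G i))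
    (hpath : ∀ u hu hD, P (pathGraph u hu hD)) (j : S.Site) : P (S.part j) := by
  rcases j with ⟨a, ha⟩ | ⟨⟨⟩⟩ | ⟨⟨⟩⟩
  · exact hG (S.cls a - 1) (by omega)
  · exact hG _ (by omega)
  · exact hpath _ (reduced_pathColors (reduced_nthWord _)) (head_pathColors (reduced_nthWord _))

theorem connected_result (hm : 0 < m) (hn : 0 < n)
    (hG : ∀ i < n, (G i).graph.toSimple.Connected) : S.result.graph.toSimple.Connected :=
  connected_glue _ _ _ _ _ _ _ (S.connected_H hm)
    (S.part_property (P := fun M => M.graph.toSimple.Connected) hn hG connected_pathGraph)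

theorem finite_W (hN : ∀ i, (N i).FiniteIndex) : Finite S.W := by
  rcases Nat.even_or_odd n with hn | hn
  · obtain ⟨i, e, -⟩ := S.shape_even hn
    exact Finite.of_equiv _ e.symm
  · obtain ⟨i, e, -⟩ := S.shape_odd hn
    have := hN i
    exact Finite.of_equiv _ e.symm

theorem finite_result (hN : ∀ i, (N i).FiniteIndex) (hn : 0 < n) (hG : ∀ i < n, Finite (G i).V) :
    Finite S.result.V := by
  have := S.finite_W hN
  have h : ∀ j, Finite (S.part j).V := S.part_property (P := fun M => Finite M.V) hn hG
    fun u _ _ => inferInstanceAs (Finite (Fin (u.length + 1)))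
  exact inferInstanceAs (Finite (S.W ⊕ Σ j, (S.part j).V))

end StepChoice

namespace Construction

variable {m : ℕ} (K : Construction m)

theorem connected_G (hm : 0 < m) (n : ℕ) : (K.G n).graph.toSimple.Connected := by
  induction n using Nat.strong_induction_on with
  | _ n ih =>
    match n with
    | 0 => exact K.zero.connected connected_singleVertex
    | 1 => exact K.one.connected (connected_glue _ _ _ _ _ _ _ connected_triangle
        fun _ => ih 0 (by omega))
    | n + 2 => exact (K.step n).connected ((K.choice n).connected_result hm (by omega) ih)

theorem finite_G (n : ℕ) : Finite (K.G n).V := by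
  induction n using Nat.strong_induction_on with
  | _ n ih =>
    match n with
    | 0 => exact Finite.of_equiv Unit K.zero.toEquiv.symm
    | 1 =>
      have := ih 0 (by omega)
      exact Finite.of_equiv (Fin 3 ⊕ Σ _ : Unit, (K.G 0).V) K.one.toEquiv.symm
    | n + 2 =>
      have := (K.choice n).finite_result K.finiteIndex (by omega) ih
      exact Finite.of_equiv _ (K.step n).toEquiv.symm

/-! ### The boundary of `G_n` in the union -/

theorem root_notMem_range_incl (n : ℕ) : (K.G (n + 1)).root ∉ Set.range (K.incl n) := by
  rintro ⟨x, hx⟩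
  cases n with
  | zero =>
    have h := congrArg K.one.toEquiv hx
    rw [K.one.map_root] at h
    unfold incl at h
    erw [Equiv.apply_symm_apply] at h
    cases h
  | succ n =>
    have h := congrArg (K.step n).toEquiv hx
    rw [(K.step n).map_root] at h
    unfold incl at h
    erw [Equiv.apply_symm_apply] at h
    cases h

theorem mem_range_or_eq_root_of_glueAdj {W J : Type} {H : ColoredGraph W} {pos : J → W}
    {M : J → Marked} {c : Color} {j : J} {x : (M j).V} {y : W ⊕ Σ j, (M j).V}
    (h : GlueAdj H pos M c (Sum.inr ⟨j, x⟩) y) :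
    (∃ y', y = Sum.inr ⟨j, y'⟩) ∨ x = (M j).root := by
  cases h with
  | piece _ h => exact Or.inl ⟨_, rfl⟩
  | bridge' _ => exact Or.inr rfl

theorem mem_range_incl_or_eq_root {n : ℕ} {c : Color} {x : (K.G n).V} {y : (K.G (n + 1)).V}
    (h : (K.G (n + 1)).graph.Adj c (K.incl n x) y) :
    y ∈ Set.range (K.incl n) ∨ x = (K.G n).root := by
  cases n with
  | zero =>
    rw [K.one.isColorIso] at h
    unfold incl at h
    erw [Equiv.apply_symm_apply] at h
    rcases mem_range_or_eq_root_of_glueAdj (M := fun _ : Unit => K.G 0) h with ⟨y', hy⟩ | h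
    · exact Or.inl ⟨y', (Equiv.symm_apply_eq K.one.toEquiv).2 hy.symm⟩
    · exact Or.inr h
  | succ n =>
    rw [(K.step n).isColorIso] at h
    unfold incl at h
    erw [Equiv.apply_symm_apply] at h
    rcases mem_range_or_eq_root_of_glueAdj (M := (K.choice n).part) h with ⟨y', hy⟩ | h
    · exact Or.inl ⟨y', (Equiv.symm_apply_eq (K.step n).toEquiv).2 hy.symm⟩
    · exact Or.inr h

theorem inclLE_succ {i j : ℕ} (h : i ≤ j) (x : (K.G i).V) :
    K.inclLE i (j + 1) (Nat.le_succ_of_le h) x = K.incl j (K.inclLE i j h x) :=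
  Nat.leRecOn_succ (C := fun n => (K.G n).V) h x

theorem inclLE_self (i : ℕ) (x : (K.G i).V) : K.inclLE i i le_rfl x = x :=
  Nat.leRecOn_self (C := fun n => (K.G n).V) x

/-- An edge leaving `G_j` inside `G_{j+1}` starts at the root of `G_j`. For `j > n` that root is not
in `G_{j-1}`, hence not in `G_n`, so nothing new leaves `G_n` after step `n + 1`. -/
theorem mem_range_inclLE_or_eq_root {n j : ℕ} (hnj : n ≤ j) {c : Color} {x : (K.G n).V}
    {y : (K.G j).V} (h : (K.G j).graph.Adj c (K.inclLE n j hnj x) y) :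
    y ∈ Set.range (K.inclLE n j hnj) ∨ x = (K.G n).root := by
  induction j, hnj using Nat.le_induction with
  | base => exact Or.inl ⟨y, K.inclLE_self n y⟩
  | succ j hnj ih =>
    rw [K.inclLE_succ hnj] at h
    rcases K.mem_range_incl_or_eq_root h with ⟨y', rfl⟩ | hr
    · rw [K.incl_adj] at h
      rcases ih h with ⟨z, rfl⟩ | hr
      · exact Or.inl ⟨z, K.inclLE_succ hnj z⟩
      · exact Or.inr hr
    · rcases hnj.eq_or_lt with rfl | hlt
      · rw [K.inclLE_self] at hr
        exact Or.inr hr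
      · obtain ⟨k, rfl⟩ : ∃ k, j = k + 1 := ⟨j - 1, by omega⟩
        rw [K.inclLE_succ (by omega)] at hr
        exact (K.root_notMem_range_incl k ⟨_, hr⟩).elim

theorem exists_eq_toVertex (a : K.Vertex) : ∃ n x, K.toVertex n x = a := by
  obtain ⟨n, x, h⟩ := DirectLimit.exists_eq_mk (fun i j h => K.inclLE i j h) a
  exact ⟨n, x, h.symm⟩

theorem toVertex_incl (n : ℕ) (x : (K.G n).V) :
    K.toVertex (n + 1) (K.incl n x) = K.toVertex n x := by
  rw [← K.toVertex_inclLE n (n + 1) (Nat.le_succ n), K.inclLE_succ le_rfl, K.inclLE_self]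

theorem subgraphSet_mono : Monotone K.subgraphSet := by
  refine monotone_nat_of_le_succ fun n => ?_
  rintro _ ⟨x, rfl⟩
  exact ⟨K.incl n x, K.toVertex_incl n x⟩

theorem iUnion_subgraphSet : ⋃ n, K.subgraphSet n = Set.univ := by
  refine Set.eq_univ_of_forall fun a => ?_
  obtain ⟨n, x, rfl⟩ := K.exists_eq_toVertex a
  exact Set.mem_iUnion.2 ⟨n, x, rfl⟩

theorem finite_subgraphSet (n : ℕ) : (K.subgraphSet n).Finite :=
  have := K.finite_G n
  Set.finite_range _

theorem eq_root_of_adj {n : ℕ} {c : Color} {a b : K.Vertex} (ha : a ∈ K.subgraphSet n)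
    (hb : b ∉ K.subgraphSet n) (h : K.graph.Adj c a b) : a = K.toVertex n (K.G n).root := by
  obtain ⟨x, rfl⟩ := ha
  obtain ⟨k, y, rfl⟩ := K.exists_eq_toVertex b
  rw [← K.toVertex_inclLE k (max k n) (le_max_left _ _)] at h hb
  rw [← K.toVertex_inclLE n (max k n) (le_max_right _ _) x] at h
  rcases K.mem_range_inclLE_or_eq_root _ (K.limitAdj_iff.1 h) with ⟨z, hz⟩ | hr
  · rw [← hz, K.toVertex_inclLE] at hb
    exact (hb ⟨z, rfl⟩).elim
  · rw [hr]

/-- The root of `G_{n+1}` is a vertex outside `G_n`, so the sizes increase strictly. -/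
theorem lt_ncard_subgraphSet (n : ℕ) : n < (K.subgraphSet n).ncard := by
  induction n with
  | zero =>
    rw [Set.ncard_pos (K.finite_subgraphSet 0)]
    exact ⟨_, (K.G 0).root, rfl⟩
  | succ n ih =>
    refine lt_of_le_of_lt (Nat.succ_le_of_lt ih)
      (Set.ncard_lt_ncard ?_ (K.finite_subgraphSet (n + 1)))
    refine (Set.ssubset_iff_of_subset (K.subgraphSet_mono (Nat.le_succ n))).2
      ⟨K.toVertex (n + 1) (K.G (n + 1)).root, ⟨_, rfl⟩, ?_⟩
    rintro ⟨x, hx⟩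
    rw [← K.toVertex_incl] at hx
    exact K.root_notMem_range_incl n ⟨x, K.toVertex_injective _ hx⟩

theorem connected_graph (hm : 0 < m) : K.graph.toSimple.Connected where
  nonempty := ⟨K.toVertex 0 (K.G 0).root⟩
  preconnected := by
    intro a b
    obtain ⟨n, x, y, rfl, rfl⟩ := DirectLimit.exists_eq_mk₂ (fun i j h => K.inclLE i j h) a b
    let f : (K.G n).graph.toSimple →g K.graph.toSimple :=
      { toFun := K.toVertex n
        map_rel' := fun ⟨c, h⟩ => ⟨c, K.limitAdj_iff.2 h⟩ }
    exact ((K.connected_G hm n).preconnected x y).map f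

theorem tendsto_inv_ncard :
    Tendsto (fun n => (1 : ℝ) / ((K.subgraphSet n).ncard : ℝ)) atTop (𝓝 0) := by
  refine squeeze_zero (fun n => by positivity) (fun n => ?_) tendsto_one_div_add_atTop_nhds_zero_nat
  have h : ((n + 1 : ℕ) : ℝ) ≤ (K.subgraphSet n).ncard := Nat.cast_le.2 (K.lt_ncard_subgraphSet n)
  push_cast at h
  exact one_div_le_one_div_of_le (by positivity) h

theorem exhaustingSmallBoundary_subgraphSet :
    ExhaustingSmallBoundary K.graph.toSimple K.subgraphSet where
  finite := K.finite_subgraphSet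
  mono := K.subgraphSet_mono
  exhausts := K.iUnion_subgraphSet
  boundary := by
    refine squeeze_zero (fun n => by positivity) (fun n => ?_) K.tendsto_inv_ncard
    gcongr
    have hsub : vertexBoundary K.graph.toSimple (K.subgraphSet n) ⊆
        {K.toVertex n (K.G n).root} := by
      rintro a ⟨ha, b, hb, c, h⟩
      exact K.eq_root_of_adj ha hb h
    have := Set.ncard_le_ncard hsub
    rw [Set.ncard_singleton] at this
    exact_mod_cast this

end Construction

/-! ### Consequences for the action -/

theorem ColoredGraph.exists_action_eq_of_reachable {V : Type*} (G : ColoredGraph V) {x y : V}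
    (h : G.toSimple.Reachable x y) : ∃ g : Gam, G.action g x = y := by
  obtain ⟨w⟩ := h
  induction w with
  | nil => exact ⟨1, by simp⟩
  | cons h _ ih =>
    obtain ⟨c, hc⟩ := h
    obtain ⟨g, rfl⟩ := ih
    exact ⟨g * gen c, by rw [map_mul, Equiv.Perm.mul_apply, G.action_gen, G.move_of_adj hc]⟩

theorem ColoredGraph.schreierGraph_action {V : Type*} (G : ColoredGraph V) :
    schreierGraph G.action = G.toSimple := by
  ext x y
  have key : ∀ x y : V, x ≠ y → (∃ c, x = G.action (gen c) y) → G.toSimple.Adj x y := by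
    rintro x y hne ⟨c, rfl⟩
    rw [G.action_gen] at hne ⊢
    by_cases h : ∃ z, G.Adj c y z
    · obtain ⟨z, hz⟩ := h
      rw [G.move_of_adj hz]
      exact ⟨c, G.symm hz⟩
    · exact (hne (G.move_of_not h)).elim
  rw [schreierGraph, SimpleGraph.fromRel_adj]
  constructor
  · rintro ⟨hne, h | h⟩
    · exact key x y hne h
    · exact (key y x hne.symm h).symm
  · intro h
    refine ⟨h.ne, Or.inl ?_⟩
    obtain ⟨c, hc⟩ := h
    exact ⟨c, by rw [G.action_gen, G.move_of_adj (G.symm hc)]⟩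

theorem ColoredGraph.bounded_degree {V : Type*} (G : ColoredGraph V) (x : V) :
    (G.toSimple.neighborSet x).Finite ∧ (G.toSimple.neighborSet x).ncard ≤ 4 := by
  classical
  let F : Finset V := ({Color.A, Color.B, Color.C, Color.D} : Finset Color).image
    fun c => G.move c x
  have hsub : G.toSimple.neighborSet x ⊆ F := by
    rintro y ⟨c, hc⟩
    refine Finset.mem_coe.2 (Finset.mem_image.2 ⟨c, by cases c <;> simp, G.move_of_adj hc⟩)
  refine ⟨F.finite_toSet.subset hsub, ?_⟩
  have h1 := Set.ncard_le_ncard hsub F.finite_toSet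
  rw [Set.ncard_coe_finset] at h1
  exact h1.trans (Finset.card_image_le.trans (by decide))

/-- If only one vertex of a finite set has a neighbour outside, then a word moves at most as many
vertices out of the set as it has letters. -/
theorem ColoredGraph.ncard_action_image_diff_le {V : Type*} (G : ColoredGraph V) {S : Set V}
    (hS : S.Finite) {r : V} (hr : ∀ c, ∀ a ∈ S, ∀ b ∉ S, G.Adj c a b → a = r) (w : List Color) :
    (G.action (wordElt w) '' S \ S).ncard ≤ w.length := by
  induction w with
  | nil => simp [wordElt]
  | cons c w ih =>
    -- A vertex ends outside either because `w` had already moved it out, or because the last step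
    -- along `c` crosses the boundary; the latter happens only at `r`.
    have hsub : G.action (wordElt (c :: w)) '' S \ S ⊆
        G.action (gen c) '' (G.action (wordElt w) '' S \ S) ∪ {G.move c r} := by
      rintro _ ⟨⟨x, hx, rfl⟩, hn⟩
      rw [wordElt_cons, map_mul, Equiv.Perm.mul_apply] at hn ⊢
      by_cases h : G.action (wordElt w) x ∈ S
      · right
        rw [G.action_gen] at hn ⊢
        by_cases he : ∃ z, G.Adj c (G.action (wordElt w) x) z
        · obtain ⟨z, hz⟩ := he
          rw [G.move_of_adj hz] at hn
          rw [hr c _ h z hn hz]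
          rfl
        · rw [G.move_of_not he] at hn
          exact (hn h).elim
      · exact Or.inl ⟨_, ⟨⟨x, hx, rfl⟩, h⟩, rfl⟩
    have hfin : (G.action (wordElt w) '' S \ S).Finite := (hS.image _).sdiff
    refine (Set.ncard_le_ncard hsub ((hfin.image _).union (Set.finite_singleton _))).trans ?_
    refine (Set.ncard_union_le _ _).trans ?_
    rw [Set.ncard_singleton, List.length_cons]
    have := Set.ncard_image_le (f := G.action (gen c)) hfin
    omega

namespace Construction

variable {m : ℕ} (K : Construction m)

theorem tendsto_ncard_action_diff (g : Gam) :
    Tendsto (fun n => ((K.graph.action g '' K.subgraphSet n \ K.subgraphSet n).ncard : ℝ) /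
      ((K.subgraphSet n).ncard : ℝ)) atTop (𝓝 0) := by
  obtain ⟨w, -, -, rfl⟩ := exists_reduced_word (s := Set.univ) (g := g)
    (by rw [Set.image_univ, closure_range_gen]; trivial)
  have h := K.tendsto_inv_ncard.const_mul (w.length : ℝ)
  rw [mul_zero] at h
  refine squeeze_zero (fun n => by positivity) (fun n => ?_) h
  rw [mul_one_div]
  gcongr
  exact K.graph.ncard_action_image_diff_le (K.finite_subgraphSet n)
    (fun c a ha b hb h => K.eq_root_of_adj ha hb h) w

theorem folnerSequence_subgraphSet : FolnerSequence K.graph.action K.subgraphSet where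
  finite := K.finite_subgraphSet
  tendsto g := by
    have h := (K.tendsto_ncard_action_diff g).add_const 1
    rw [zero_add] at h
    refine h.congr fun n => ?_
    have hfin := K.finite_subgraphSet n
    have hpos : ((K.subgraphSet n).ncard : ℝ) ≠ 0 := by
      exact Nat.cast_ne_zero.2 (K.lt_ncard_subgraphSet n).ne_bot
    rw [← Set.sdiff_union_self, Set.ncard_union_eq Set.disjoint_sdiff_left
      ((hfin.image _).sdiff) hfin]
    push_cast
    field_simp

theorem stronglyAmenable (hm : 0 < m) : StronglyAmenable (schreierGraph K.graph.action) := by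
  rw [K.graph.schreierGraph_action]
  refine ⟨?_, K.connected_graph hm, ⟨4, K.graph.bounded_degree⟩,
    ⟨_, K.exhaustingSmallBoundary_subgraphSet⟩⟩
  by_contra hfin
  rw [not_infinite_iff_finite] at hfin
  have h1 := K.lt_ncard_subgraphSet (Nat.card K.Vertex)
  have h2 := Set.ncard_le_ncard (Set.subset_univ (K.subgraphSet (Nat.card K.Vertex)))
    Set.finite_univ
  rw [Set.ncard_univ] at h2
  omega

theorem action_transitive (hm : 0 < m) (x y : K.Vertex) : ∃ g : Gam, K.graph.action g x = y :=
  K.graph.exists_action_eq_of_reachable ((K.connected_graph hm).preconnected x y)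

end Construction

/-! ### Amenability -/

/-- An action with a Følner sequence is amenable: take the limit of the relative sizes along an
ultrafilter. -/
theorem amenableAction_of_tendsto {Λ X : Type*} [Group Λ] (Φ : Λ →* Equiv.Perm X) (Ω : ℕ → Set X)
    (hfin : ∀ n, (Ω n).Finite) (hne : ∀ n, (Ω n).ncard ≠ 0)
    (h : ∀ g, Tendsto (fun n => ((Φ g '' Ω n \ Ω n).ncard : ℝ) / ((Ω n).ncard : ℝ)) atTop (𝓝 0)) :
    AmenableAction Φ := by
  let U : Ultrafilter ℕ := hyperfilter ℕ
  have hU : (U : Filter ℕ) ≤ atTop := Nat.hyperfilter_le_atTop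
  let ν : Set X → ℕ → ℝ := fun S n => ((S ∩ Ω n).ncard : ℝ) / ((Ω n).ncard : ℝ)
  have hν0 : ∀ S n, 0 ≤ ν S n := fun S n => by positivity
  have hν1 : ∀ S n, ν S n ≤ 1 := fun S n => div_le_one_of_le₀
    (Nat.cast_le.2 (Set.ncard_le_ncard Set.inter_subset_right (hfin n))) (by positivity)
  have hlim : ∀ S, ∃ a, Tendsto (ν S) U (𝓝 a) := by
    intro S
    -- The relative sizes stay in a compact interval, so they converge along the ultrafilter.
    obtain ⟨a, -, ha⟩ := (isCompact_Icc (a := (0 : ℝ)) (b := 1)).ultrafilter_le_nhds (U.map (ν S))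
      (by
        rw [le_principal_iff]
        exact Filter.mem_map.2 (univ_mem' fun n => ⟨hν0 S n, hν1 S n⟩))
    exact ⟨a, ha⟩
  choose μ hμ using hlim
  have hle : ∀ g S, μ (Φ g '' S) ≤ μ S := by
    intro g S
    have hb : ∀ n, ν (Φ g '' S) n ≤
        ν S n + ((Φ g⁻¹ '' Ω n \ Ω n).ncard : ℝ) / ((Ω n).ncard : ℝ) := by
      intro n
      simp only [ν]
      rw [← add_div]
      gcongr
      have hd : (Φ g⁻¹ '' Ω n \ Ω n).Finite := ((hfin n).image _).sdiff
      have hi : (S ∩ Ω n).Finite := (hfin n).inter_of_right S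
      -- Pulled back by `g⁻¹`, a point of `gS ∩ Ω n` lies in `S`; it can leave `Ω n` only through
      -- `g⁻¹Ω n \ Ω n`, which is negligible.
      have hsub : Φ g⁻¹ '' (Φ g '' S ∩ Ω n) ⊆ (S ∩ Ω n) ∪ (Φ g⁻¹ '' Ω n \ Ω n) := by
        rintro _ ⟨_, ⟨⟨x, hx, rfl⟩, hy⟩, rfl⟩
        have hxx : Φ g⁻¹ (Φ g x) = x := by simp
        rw [hxx]
        by_cases hxn : x ∈ Ω n
        · exact Or.inl ⟨hx, hxn⟩
        · exact Or.inr ⟨⟨_, hy, hxx⟩, hxn⟩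
      have h1 := Set.ncard_le_ncard hsub (hi.union hd)
      rw [Set.ncard_image_of_injective _ (Φ g⁻¹).injective] at h1
      exact_mod_cast h1.trans (Set.ncard_union_le _ _)
    have h1 := (hμ S).add ((h g⁻¹).mono_left hU)
    rw [add_zero] at h1
    exact le_of_tendsto_of_tendsto' (hμ _) h1 hb
  refine ⟨μ, fun S => ge_of_tendsto' (hμ S) (hν0 S), ?_, ?_, ?_⟩
  · refine tendsto_nhds_unique (hμ _) (tendsto_const_nhds.congr fun n => ?_)
    simp only [ν, Set.univ_inter]
    rw [div_self (Nat.cast_ne_zero.2 (hne n))]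
  · intro S T hST
    refine tendsto_nhds_unique (hμ _) (((hμ S).add (hμ T)).congr fun n => ?_)
    simp only [ν]
    rw [Set.union_inter_distrib_right, Set.ncard_union_eq
      (hST.mono Set.inter_subset_left Set.inter_subset_left)
      ((hfin n).inter_of_right S) ((hfin n).inter_of_right T)]
    push_cast
    ring
  · intro g S
    -- The reverse inequality is the same bound for `g⁻¹` and the set `gS`.
    refine le_antisymm (hle g S) ?_
    have h1 := hle g⁻¹ (Φ g '' S)
    have h2 : Φ g⁻¹ '' (Φ g '' S) = S := by
      ext x
      simp
    rwa [h2] at h1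

/-! ### Faithfulness -/

/-- A word acts nontrivially if its path is attached somewhere in the graph. -/
theorem ColoredGraph.action_wordElt_ne_one {V : Type*} (G : ColoredGraph V) {w : List Color}
    (hw : w ≠ []) (x : V) (a : ℕ → V) (hx : G.Adj Color.D x (a 0))
    (ha : ∀ i c, (pathColors w)[i]? = some c → G.Adj c (a i) (a (i + 1)))
    (hax : ∀ i, a i ≠ x) (ha0 : a (pathColors w).length = a 0 → pathColors w = []) :
    G.action (wordElt w) ≠ 1 := by
  intro h1
  have hw' : w.reverse ≠ [] := by simpa using hw
  by_cases hD : w.reverse.head? = some Color.D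
  · have hp : pathColors w = w.reverse.tail := if_pos hD
    have hcons : w.reverse = Color.D :: pathColors w := by
      rw [hp]
      exact (List.cons_head?_tail hD).symm
    -- Here the letter acting first is `D`: the walk starts at `x`, crosses the bridge and ends on
    -- the path. In the other case it starts at `a 0`.
    let f : ℕ → V := fun i => Nat.casesOn i x a
    have key := G.action_wordElt_reverse (Color.D :: pathColors w) f (by
      rintro (_ | i) c hc
      · simp only [List.getElem?_cons_zero, Option.some.injEq] at hc
        subst hc
        exact hx
      · exact ha i c (by simpa using hc))
    rw [← hcons, List.reverse_reverse, h1, hcons] at key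
    exact hax _ key.symm
  · have hp : pathColors w = w.reverse := if_neg hD
    have key := G.action_wordElt_reverse (pathColors w) a ha
    rw [hp, List.reverse_reverse, h1, ← hp] at key
    exact hw' (hp ▸ ha0 key.symm)

namespace Construction

variable {m : ℕ} (K : Construction m)

theorem action_injective : Function.Injective K.graph.action := by
  rw [injective_iff_map_eq_one]
  intro g hg
  by_contra hne
  obtain ⟨w, hw, hnil, rfl⟩ := exists_reduced_word_ne_nil hne
  obtain ⟨n, rfl⟩ := exists_nthWord_succ_eq hw hnil
  let e : (K.choice n).result.V → K.Vertex := fun x =>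
    K.toVertex (n + 2) ((K.step n).toEquiv.symm x)
  have he : Function.Injective e :=
    (K.toVertex_injective (n + 2)).comp (K.step n).toEquiv.symm.injective
  have hadj : ∀ c x y, (K.choice n).result.graph.Adj c x y → K.graph.Adj c (e x) (e y) := by
    intro c x y h
    refine K.limitAdj_iff.2 (((K.step n).isColorIso _ _ _).2 ?_)
    rwa [Equiv.apply_symm_apply, Equiv.apply_symm_apply]
  let P : Fin ((pathColors (nthWord (n + 1))).length + 1) → (K.choice n).result.V :=
    fun i => Sum.inr ⟨Sum.inr (Sum.inr ()), i⟩
  have hP : Function.Injective P := by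
    intro i j h
    exact eq_of_heq (Sigma.mk.inj (Sum.inr.inj h)).2
  -- Step `n + 2` attaches the path of word `n + 1`. `Fin.ofNat` wraps indices beyond the end of the
  -- path, which the walk never reaches.
  refine K.graph.action_wordElt_ne_one hnil (e (Sum.inl (K.choice n).x))
    (fun i => e (P (Fin.ofNat _ i))) ?_ ?_ ?_ ?_ hg
  · exact hadj _ _ _ (GlueAdj.bridge (M := (K.choice n).part) (Sum.inr (Sum.inr ())))
  · intro i c hc
    exact hadj _ _ _ (GlueAdj.piece (M := (K.choice n).part) (Sum.inr (Sum.inr ()))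
      (pathGraph_adj_succ (hu := reduced_pathColors (reduced_nthWord _))
        (hD := head_pathColors (reduced_nthWord _)) hc))
  · intro i h
    cases he h
  · intro h
    have h1 := congrArg Fin.val (hP (he h))
    simpa using h1

theorem amenableAction : AmenableAction K.graph.action :=
  amenableAction_of_tendsto _ K.subgraphSet K.finite_subgraphSet
    (fun n => (K.lt_ncard_subgraphSet n).ne_bot) K.tendsto_ncard_action_diff

end Construction

/-! ### Partitions into separated nets -/

/-- A maximal separated subset of `U` works: a point of `U` far from all of it could be added. -/
theorem exists_separated_net {V : Type*} [Finite V] (G : SimpleGraph V) {d : ℕ} (hd : 0 < d)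
    (U : Set V) : ∃ R ⊆ U, (∀ x ∈ R, ∀ y ∈ R, x ≠ y → d ≤ G.dist x y) ∧
      ∀ x ∈ U, ∃ p ∈ R, G.dist p x < d := by
  obtain ⟨R, ⟨hRU, hsep⟩, hmax⟩ := (Set.toFinite
    {R : Set V | R ⊆ U ∧ ∀ x ∈ R, ∀ y ∈ R, x ≠ y → d ≤ G.dist x y}).exists_maximal
    ⟨∅, Set.empty_subset _, by simp⟩
  refine ⟨R, hRU, hsep, fun x hx => ?_⟩
  by_contra! hno
  have hxR : x ∉ R := fun h => by
    have := hno x h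
    rw [SimpleGraph.dist_self] at this
    omega
  refine hxR (hmax (y := insert x R) ⟨Set.insert_subset hx hRU, ?_⟩ (Set.subset_insert _ _)
    (Set.mem_insert _ _))
  rintro a (rfl | ha) b (rfl | hb) hab
  · exact (hab rfl).elim
  · rw [SimpleGraph.dist_comm]
    exact hno b hb
  · exact hno a ha
  · exact hsep a ha b hb hab

/-- By the triangle inequality through `x`, one end of a diameter is at distance at least `L` from
`x`; a shortest path to it is followed for `L` steps. -/
theorem exists_path_of_two_mul_le_diam {V : Type*} [Nonempty V] {G : SimpleGraph V}
    (hG : G.Connected) {L : ℕ} (hL : 2 * L ≤ G.diam) (x : V) :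
    ∃ f : ℕ → V, f 0 = x ∧ Set.InjOn f {t | t ≤ L} ∧
      ∀ a b, a ≤ b → b ≤ L → G.dist (f a) (f b) ≤ b - a := by
  obtain ⟨y, hy⟩ : ∃ y, L ≤ G.dist x y := by
    obtain ⟨u, v, huv⟩ := G.exists_dist_eq_diam
    have h := hG.dist_triangle (u := u) (v := x) (w := v)
    rw [G.dist_comm (u := u) (v := x)] at h
    by_contra! hno
    have h1 := hno u
    have h2 := hno v
    omega
  obtain ⟨p, hp, hlen⟩ := hG.exists_path_of_dist x y
  refine ⟨p.getVert, p.getVert_zero, ?_, ?_⟩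
  · exact hp.getVert_injOn.mono fun t (ht : t ≤ L) => (by simp only [Set.mem_ofPred_eq]; omega)
  · intro a b hab
    induction b, hab using Nat.le_induction with
    | base => simp
    | succ b hab ih =>
      intro hb
      have h1 := ih (by omega)
      have h2 := hG.dist_triangle (u := p.getVert a) (v := p.getVert b) (w := p.getVert (b + 1))
      rw [SimpleGraph.dist_eq_one_iff_adj.2 (p.adj_getVert_succ (by omega))] at h2
      omega

/-- Separated sets `{cls = i}`, `1 ≤ i ≤ k`, at exponentially growing scales leave at least two
vertices uncovered in the vicinity of every vertex. -/
theorem exists_two_unassigned {V : Type*} [Nonempty V] {G : SimpleGraph V} (hG : G.Connected)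
    (s : ℕ → ℕ) (hs : ∀ i, 2 ^ i ≤ s i) (k : ℕ) (hk : 2 * (2 * k + 2) ≤ G.diam) (cls : V → ℕ)
    (hcls : ∀ x, cls x ≤ k)
    (hsep : ∀ i ∈ Finset.Icc 1 k, ∀ x y, x ≠ y → cls x = i → cls y = i → 2 * s i ≤ G.dist x y)
    (x : V) : ∃ y z, y ≠ z ∧ cls y = 0 ∧ cls z = 0 ∧ G.dist x y ≤ 2 * k + 2 := by
  obtain ⟨f, rfl, hinj, hdist⟩ := exists_path_of_two_mul_le_diam hG hk x
  let T := Finset.range (2 * k + 3)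
  have hclass : ∀ i ∈ Finset.Icc 1 k,
      (T.filter fun t => cls (f t) = i).card ≤ (k + 1) / 2 ^ i + 1 := by
    intro i hi
    have hpos : 0 < 2 ^ i := by positivity
    have hsi := hs i
    -- Cut the path into blocks of `2 * s i` consecutive positions. Two vertices of class `i` in one
    -- block would be too close, so each block contains at most one.
    have hmap : (T.filter fun t => cls (f t) = i).card ≤
        (Finset.range ((2 * k + 2) / (2 * s i) + 1)).card := by
      refine Finset.card_le_card_of_injOn (fun t => t / (2 * s i)) ?_ ?_
      · intro t ht
        simp only [T, Finset.coe_filter, Finset.mem_range, Set.mem_ofPred_eq, Finset.coe_range,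
          Set.mem_Iio] at ht ⊢
        exact Nat.lt_succ_of_le (Nat.div_le_div_right (by omega))
      · have key : ∀ a b, a < b → b ≤ 2 * k + 2 → cls (f a) = i → cls (f b) = i →
            a / (2 * s i) ≠ b / (2 * s i) := by
          intro a b hab hb ha' hb' heq
          have hne : f a ≠ f b := fun h => hab.ne
            (hinj (by simp only [Set.mem_ofPred_eq]; omega) (by simpa using hb) h)
          have h1 := hsep i hi _ _ hne ha' hb'
          have h2 := hdist a b hab.le hb
          have h3 := Nat.div_add_mod a (2 * s i)
          have h4 := Nat.div_add_mod b (2 * s i)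
          have h5 := Nat.mod_lt b (show 0 < 2 * s i by omega)
          rw [heq] at h3
          omega
        intro a ha b hb heq
        simp only [T, Finset.coe_filter, Finset.mem_range, Set.mem_ofPred_eq] at ha hb
        rcases lt_trichotomy a b with h | h | h
        · exact (key a b h (by omega) ha.2 hb.2 heq).elim
        · exact h
        · exact (key b a h (by omega) hb.2 ha.2 heq.symm).elim
    rw [Finset.card_range] at hmap
    refine hmap.trans (Nat.succ_le_succ ?_)
    rw [show 2 * k + 2 = 2 * (k + 1) by ring, Nat.mul_div_mul_left _ _ (by norm_num)]
    exact Nat.div_le_div_left hsi hpos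
  have hsum : ((Finset.Icc 1 k).biUnion fun i => T.filter fun t => cls (f t) = i).card ≤
      2 * k + 1 := by
    refine Finset.card_biUnion_le.trans ((Finset.sum_le_sum hclass).trans ?_)
    rw [Finset.sum_add_distrib, Finset.sum_const, Nat.card_Icc]
    -- The terms `(k + 1) / 2 ^ i` sum to at most `k + 1`, and the `k` extra ones bring the total to
    -- `2 * k + 1`. Of the `2 * k + 3` path vertices, two remain free.
    have h := Nat.geom_sum_Ico_le (b := 2) le_rfl (k + 1) (k + 1)
    rw [show Finset.Ico 1 (k + 1) = Finset.Icc 1 k from rfl] at h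
    simp at h ⊢
    omega
  have hcard : 1 < (T.filter fun t => cls (f t) = 0).card := by
    have hT : T ⊆ (T.filter fun t => cls (f t) = 0) ∪
        ((Finset.Icc 1 k).biUnion fun i => T.filter fun t => cls (f t) = i) := by
      intro t ht
      by_cases h0 : cls (f t) = 0
      · exact Finset.mem_union_left _ (Finset.mem_filter.2 ⟨ht, h0⟩)
      · refine Finset.mem_union_right _ (Finset.mem_biUnion.2 ⟨cls (f t), ?_, ?_⟩)
        · exact Finset.mem_Icc.2 ⟨by omega, hcls _⟩
        · exact Finset.mem_filter.2 ⟨ht, rfl⟩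
    have h1 := (Finset.card_le_card hT).trans (Finset.card_union_le _ _)
    rw [Finset.card_range] at h1
    omega
  obtain ⟨a, ha, b, hb, hab⟩ := Finset.one_lt_card.1 hcard
  simp only [T, Finset.mem_filter, Finset.mem_range] at ha hb
  refine ⟨f a, f b, fun h => hab (hinj ?_ ?_ h), ha.2, hb.2,
    (hdist 0 a (Nat.zero_le _) (by omega)).trans (by omega)⟩
  · simp only [Set.mem_ofPred_eq]; omega
  · simp only [Set.mem_ofPred_eq]; omega

/-- Greedy choice by induction on `k`, with class `0` standing for the vertices still free. -/
theorem exists_net_partition {V : Type*} [Finite V] [Nonempty V] {G : SimpleGraph V}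
    (hG : G.Connected) (s : ℕ → ℕ) (hs : ∀ i, 2 ^ i ≤ s i) (k : ℕ)
    (hk : 4 * (k + 1) ≤ G.diam) :
    ∃ cls : V → ℕ, (∀ x, cls x ≤ k) ∧
      (∀ i ∈ Finset.Icc 1 k, ∀ x y, x ≠ y → cls x = i → cls y = i → 2 * s i ≤ G.dist x y) ∧
      ∀ i ∈ Finset.Icc 1 k, ∀ x, ∃ p, cls p = i ∧ G.dist p x ≤ 10 * s i := by
  classical
  induction k with
  | zero => exact ⟨fun _ => 0, by simp, by simp, by simp⟩
  | succ k ih =>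
    obtain ⟨cls, hle, hsep, hcov⟩ := ih (by omega)
    have hk1 : k + 1 < 2 ^ (k + 1) := Nat.lt_two_pow_self
    have hsk := hs (k + 1)
    obtain ⟨R, hRU, hR, hRcov⟩ := exists_separated_net G
      (show 0 < 2 * s (k + 1) by omega) {x | cls x = 0}
    have hne : ∀ i ∈ Finset.Icc 1 (k + 1), i ≠ k + 1 → i ∈ Finset.Icc 1 k := by
      intro i hi h
      rw [Finset.mem_Icc] at hi ⊢
      omega
    have hsame : ∀ i, i ≠ 0 → i ≠ k + 1 → ∀ x, (if x ∈ R then k + 1 else cls x) = i ↔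
        cls x = i := by
      intro i h0 hi x
      split_ifs with h
      · have : cls x = 0 := hRU h
        omega
      · rfl
    have hlast : ∀ x, (if x ∈ R then k + 1 else cls x) = k + 1 ↔ x ∈ R := by
      intro x
      have := hle x
      split_ifs with h
      · simp [h]
      · simp only [h, iff_false]
        omega
    refine ⟨fun x => if x ∈ R then k + 1 else cls x, ?_, ?_, ?_⟩
    · intro x
      have := hle x
      dsimp only
      split_ifs <;> omega
    · intro i hi x y hxy hx hy
      have hi0 : i ≠ 0 := by have := Finset.mem_Icc.1 hi; omega
      by_cases h : i = k + 1
      · subst h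
        exact hR x ((hlast x).1 hx) y ((hlast y).1 hy) hxy
      · exact hsep i (hne i hi h) x y hxy ((hsame i hi0 h x).1 hx) ((hsame i hi0 h y).1 hy)
    · intro i hi x
      have hi0 : i ≠ 0 := by have := Finset.mem_Icc.1 hi; omega
      by_cases h : i = k + 1
      · subst h
        -- A free `y` lies within `2 * k + 2` of `x`, and a net point within `2 * s (k + 1)` of `y`.
        -- Since `k + 1 < s (k + 1)`, the sum is below `10 * s (k + 1)`.
        obtain ⟨y, -, -, hy, -, hxy⟩ := exists_two_unassigned hG s hs k (by omega) cls hle hsep x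
        obtain ⟨p, hp, hpy⟩ := hRcov y hy
        refine ⟨p, (hlast p).2 hp, ?_⟩
        have h1 := hG.dist_triangle (u := p) (v := y) (w := x)
        rw [G.dist_comm (u := y)] at h1
        omega
      · obtain ⟨p, hp, hpx⟩ := hcov i (hne i hi h) x
        exact ⟨p, (hsame i hi0 h p).2 hp, hpx⟩

/-! ### The cycles -/

theorem cycleAdj_A_iff {i : ℕ} {x y : Fin (2 * i)} : cycleAdj i Color.A x y ↔
    (x.val % 2 = 0 ∧ y.val = x.val + 1) ∨ (y.val % 2 = 0 ∧ x.val = y.val + 1) := by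
  simp only [cycleAdj]
  constructor
  · rintro ⟨k, h | h⟩ <;> omega
  · rintro (h | h)
    · exact ⟨x.val / 2, by omega⟩
    · exact ⟨y.val / 2, by omega⟩

theorem cycleAdj_B_iff {i : ℕ} {x y : Fin (2 * i)} : cycleAdj i Color.B x y ↔
    (x.val % 2 = 1 ∧ (y.val = x.val + 1 ∨ (x.val + 1 = 2 * i ∧ y.val = 0))) ∨
    (y.val % 2 = 1 ∧ (x.val = y.val + 1 ∨ (y.val + 1 = 2 * i ∧ x.val = 0))) := by
  have hx := x.isLt
  have hy := y.isLt
  have key : ∀ a b : ℕ, a < 2 * i → b < 2 * i →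
      ((∃ k, a = 2 * k + 1 ∧ b = (2 * k + 2) % (2 * i)) ↔
        (a % 2 = 1 ∧ (b = a + 1 ∨ (a + 1 = 2 * i ∧ b = 0)))) := by
    intro a b ha hb
    constructor
    · rintro ⟨k, rfl, rfl⟩
      refine ⟨by omega, ?_⟩
      rcases (show 2 * k + 2 ≤ 2 * i by omega).eq_or_lt with h | h
      · exact Or.inr ⟨h, by rw [h, Nat.mod_self]⟩
      · exact Or.inl (by rw [Nat.mod_eq_of_lt h])
    · rintro ⟨h, h'⟩
      refine ⟨a / 2, by omega, ?_⟩
      rw [show 2 * (a / 2) + 2 = a + 1 by omega]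
      rcases h' with h' | ⟨h', rfl⟩
      · rw [← h', Nat.mod_eq_of_lt hb]
      · rw [h', Nat.mod_self]
  simp only [cycleAdj]
  rw [exists_or]
  exact or_congr (key _ _ hx hy) (key _ _ hy hx)

/-- The cycle of length `2 * i` as a coloured graph. -/
def cycleGraph (i : ℕ) (hi : 2 ≤ i) : ColoredGraph (Fin (2 * i)) where
  Adj := cycleAdj i
  symm := by
    rintro (_ | _ | _ | _) x y h
    · rw [cycleAdj_A_iff] at h ⊢
      exact h.symm
    · rw [cycleAdj_B_iff] at h ⊢
      exact h.symm
    · exact h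
    · exact h
  loopless := by
    rintro (_ | _ | _ | _) x h
    · rw [cycleAdj_A_iff] at h
      omega
    · rw [cycleAdj_B_iff] at h
      omega
    · exact h
    · exact h
  color_unique := by
    rintro (_ | _ | _ | _) (_ | _ | _ | _) x y h h' <;>
      first
      | rfl
      | exact h.elim
      | exact h'.elim
      | (rw [cycleAdj_A_iff] at h; rw [cycleAdj_B_iff] at h'; omega)
      | (rw [cycleAdj_B_iff] at h; rw [cycleAdj_A_iff] at h'; omega)
  proper := by
    rintro (_ | _ | _ | _) x y z h h'
    · rw [cycleAdj_A_iff] at h h'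
      exact Fin.ext (by omega)
    · rw [cycleAdj_B_iff] at h h'
      exact Fin.ext (by omega)
    · exact h.elim
    · exact h.elim

theorem cycleGraph_adj_iff {i : ℕ} (hi : 2 ≤ i) {x y : Fin (2 * i)} :
    (cycleGraph i hi).toSimple.Adj x y ↔ (y.val = x.val + 1 ∨ x.val = y.val + 1) ∨
      (x.val + 1 = 2 * i ∧ y.val = 0) ∨ (y.val + 1 = 2 * i ∧ x.val = 0) := by
  constructor
  · rintro ⟨(_ | _ | _ | _), h⟩
    · have := cycleAdj_A_iff.1 h
      omega
    · have := cycleAdj_B_iff.1 h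
      omega
    · exact h.elim
    · exact h.elim
  · intro h
    by_cases hA : (x.val % 2 = 0 ∧ y.val = x.val + 1) ∨ (y.val % 2 = 0 ∧ x.val = y.val + 1)
    · exact ⟨Color.A, cycleAdj_A_iff.2 hA⟩
    · exact ⟨Color.B, cycleAdj_B_iff.2 (by omega)⟩

theorem connected_cycleGraph {i : ℕ} (hi : 2 ≤ i) : (cycleGraph i hi).toSimple.Connected := by
  refine SimpleGraph.connected_iff_exists_forall_reachable _ |>.2 ⟨⟨0, by omega⟩, ?_⟩
  rintro ⟨k, hk⟩
  induction k with
  | zero => exact SimpleGraph.Reachable.refl _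
  | succ k ih =>
    exact (ih (by omega)).trans
      (SimpleGraph.Adj.reachable ((cycleGraph_adj_iff hi).2 (Or.inl (Or.inl rfl))))

theorem le_diam_cycleGraph {i : ℕ} (hi : 2 ≤ i) : i ≤ (cycleGraph i hi).toSimple.diam := by
  -- The cyclic distance to `0` changes by at most one along an edge, and it equals `i` at the
  -- vertex `i`.
  have hwalk : ∀ {x y : Fin (2 * i)} (p : (cycleGraph i hi).toSimple.Walk x y),
      min y.val (2 * i - y.val) ≤ min x.val (2 * i - x.val) + p.length := by
    intro x y p
    induction p with
    | nil => simp
    | cons h p ih =>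
      have := (cycleGraph_adj_iff hi).1 h
      rw [SimpleGraph.Walk.length_cons]
      omega
  have hconn := connected_cycleGraph hi
  have : Nonempty (Fin (2 * i)) := ⟨⟨0, by omega⟩⟩
  refine le_trans ?_ (SimpleGraph.dist_le_diam (SimpleGraph.connected_iff_ediam_ne_top.1 hconn)
    (u := ⟨0, by omega⟩) (v := ⟨i, by omega⟩))
  obtain ⟨p, hp⟩ := hconn.exists_walk_length_eq_dist ⟨0, by omega⟩ ⟨i, by omega⟩
  have := hwalk p
  simp only at this
  omega

/-! ### The Cayley graphs -/

/-- The generator `c ≠ D` as an element of `⟨A, B, C⟩`. -/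
def genT (c : Color) (hc : c ≠ Color.D) : GamT := ⟨gen c, gen_mem_GamT hc⟩

theorem genT_mul_self (c : Color) (hc : c ≠ Color.D) : genT c hc * genT c hc = 1 :=
  Subtype.ext (gen_mul_self c)

/-- Normality turns adjacency of cosets into right multiplication in the quotient group. -/
theorem cayleyAdj_iff {N : Subgroup GamT} [N.Normal] {c : Color} {x y : GamT ⧸ N} :
    cayleyAdj N c x y ↔ ∃ hc : c ≠ Color.D, y = x * QuotientGroup.mk (genT c hc) := by
  constructor
  · rintro ⟨hc, g, rfl, rfl⟩
    exact ⟨hc, rfl⟩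
  · rintro ⟨hc, rfl⟩
    obtain ⟨g, rfl⟩ := QuotientGroup.mk_surjective x
    exact ⟨hc, g, rfl, rfl⟩

/-- The Cayley graph of the quotient by `N`, for `N` which keeps the generators distinct and
nontrivial. -/
def cayleyGraph (N : Subgroup GamT) [N.Normal] (h1 : ∀ c hc, genT c hc ∉ N)
    (h2 : ∀ c d hc hd, c ≠ d → genT c hc * genT d hd ∉ N) : ColoredGraph (GamT ⧸ N) where
  Adj := cayleyAdj N
  symm := by
    intro c x y h
    obtain ⟨hc, rfl⟩ := cayleyAdj_iff.1 h
    refine cayleyAdj_iff.2 ⟨hc, ?_⟩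
    rw [mul_assoc, ← QuotientGroup.mk_mul, genT_mul_self, QuotientGroup.mk_one, mul_one]
  loopless := by
    intro c x h
    obtain ⟨hc, h⟩ := cayleyAdj_iff.1 h
    exact h1 c hc ((QuotientGroup.eq_one_iff _).1 (left_eq_mul.1 h))
  color_unique := by
    intro c d x y h h'
    obtain ⟨hc, rfl⟩ := cayleyAdj_iff.1 h
    obtain ⟨hd, h'⟩ := cayleyAdj_iff.1 h'
    by_contra hcd
    refine h2 c d hc hd hcd ((QuotientGroup.eq_one_iff _).1 ?_)
    rw [QuotientGroup.mk_mul, mul_left_cancel h', ← QuotientGroup.mk_mul, genT_mul_self,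
      QuotientGroup.mk_one]
  proper := by
    intro c x y z h h'
    obtain ⟨hc, rfl⟩ := cayleyAdj_iff.1 h
    obtain ⟨_, rfl⟩ := cayleyAdj_iff.1 h'
    rfl

/-- The element of `⟨A, B, C⟩` given by a word without the letter `D`. -/
def wordEltT (w : List Color) (hw : ∀ c ∈ w, c ≠ Color.D) : GamT := ⟨wordElt w, wordElt_mem_GamT hw⟩

theorem wordEltT_append (v w : List Color) (hv : ∀ c ∈ v, c ≠ Color.D) (hw : ∀ c ∈ w, c ≠ Color.D) :
    wordEltT (v ++ w) (fun c hc => (List.mem_append.1 hc).elim (hv c) (hw c)) =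
      wordEltT v hv * wordEltT w hw :=
  Subtype.ext (wordElt_append v w)

theorem wordEltT_singleton (c : Color) (hc : ∀ d ∈ [c], d ≠ Color.D) :
    wordEltT [c] hc = genT c (hc c (by simp)) :=
  Subtype.ext (by simp [wordEltT, genT, wordElt])

theorem connected_cayleyGraph (N : Subgroup GamT) [N.Normal] (h1 : ∀ c hc, genT c hc ∉ N)
    (h2 : ∀ c d hc hd, c ≠ d → genT c hc * genT d hd ∉ N) :
    (cayleyGraph N h1 h2).toSimple.Connected := by
  refine SimpleGraph.connected_iff_exists_forall_reachable _ |>.2 ⟨QuotientGroup.mk 1, ?_⟩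
  have key : ∀ w hw, (cayleyGraph N h1 h2).toSimple.Reachable (QuotientGroup.mk 1)
      (QuotientGroup.mk (wordEltT w hw)) := by
    intro w
    induction w using List.reverseRecOn with
    | nil => exact fun _ => SimpleGraph.Reachable.refl _
    | append_singleton w c ih =>
      intro hw
      have hw1 : ∀ d ∈ w, d ≠ Color.D := fun d hd => hw d (by simp [hd])
      have hw2 : ∀ d ∈ [c], d ≠ Color.D := fun d hd => hw d (List.mem_append_right _ hd)
      rw [wordEltT_append w [c] hw1 hw2, wordEltT_singleton]
      exact (ih hw1).trans (SimpleGraph.Adj.reachable ⟨c, hw2 c (by simp), _, rfl, rfl⟩)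
  intro y
  obtain ⟨⟨g, hg⟩, rfl⟩ := QuotientGroup.mk_surjective y
  obtain ⟨w, -, hw, rfl⟩ := exists_reduced_word_GamT hg
  exact key w hw

theorem exists_word_of_walk {N : Subgroup GamT} [N.Normal] {h1 : ∀ c hc, genT c hc ∉ N}
    {h2 : ∀ c d hc hd, c ≠ d → genT c hc * genT d hd ∉ N} {x y : GamT ⧸ N}
    (p : (cayleyGraph N h1 h2).toSimple.Walk x y) :
    ∃ w hw, w.length = p.length ∧ y = x * QuotientGroup.mk (wordEltT w hw) := by
  induction p with
  | nil => exact ⟨[], by simp, rfl, (mul_one _).symm⟩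
  | cons h p ih =>
    obtain ⟨w, hw, hlen, rfl⟩ := ih
    obtain ⟨c, h⟩ := h
    obtain ⟨hc, rfl⟩ := cayleyAdj_iff.1 h
    have hc' : ∀ d ∈ [c], d ≠ Color.D := by simpa using hc
    refine ⟨[c] ++ w, fun d hd => (List.mem_append.1 hd).elim (hc' d) (hw d), congrArg Nat.succ hlen, ?_⟩
    rw [wordEltT_append [c] w hc' hw, QuotientGroup.mk_mul, wordEltT_singleton, mul_assoc]

instance : Finite Color :=
  Finite.of_injective (fun c : Color => match c with
    | .A => (0 : Fin 4) | .B => 1 | .C => 2 | .D => 3) (by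
    intro c d
    cases c <;> cases d <;> simp)

/-- Each nontrivial element leaves the chain at some index; as the chain decreases, the largest of
finitely many such indices serves all of them. -/
theorem exists_forall_notMem {N : ℕ → Subgroup GamT} (hanti : Antitone N) (hbot : ⨅ i, N i = ⊥)
    {F : Set GamT} (hF : F.Finite) (h1 : (1 : GamT) ∉ F) : ∃ i, ∀ g ∈ F, g ∉ N i := by
  induction F, hF using Set.Finite.induction_on with
  | empty => exact ⟨0, by simp⟩
  | @insert a F _ _ ih =>
    obtain ⟨i, hi⟩ := ih fun h => h1 (Set.mem_insert_of_mem _ h)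
    have ha : a ∉ ⨅ i, N i := by
      rw [hbot, Subgroup.mem_bot]
      rintro rfl
      exact h1 (Set.mem_insert _ _)
    rw [Subgroup.mem_iInf] at ha
    push Not at ha
    obtain ⟨j, hj⟩ := ha
    refine ⟨max i j, ?_⟩
    rintro g (rfl | hg) hgN
    · exact hj (hanti (le_max_right i j) hgN)
    · exact hi g hg (hanti (le_max_left i j) hgN)

/-! ### A residual chain in `⟨A, B, C⟩` -/

/-- The action of `Γ` on the path of the `n`-th word. -/
noncomputable def pathAction (n : ℕ) :
    Gam →* Equiv.Perm (Fin ((pathColors (nthWord n)).length + 1)) :=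
  (pathGraph (pathColors (nthWord n)) (reduced_pathColors (reduced_nthWord _))
    (head_pathColors (reduced_nthWord _))).graph.action

/-- Without the letter `D` the path carries the whole word, which moves vertex `0` to the other end.
This yields both the word problem and residual finiteness for `⟨A, B, C⟩`. -/
theorem pathAction_ne_one {n : ℕ} (hnil : nthWord n ≠ []) (hD : ∀ c ∈ nthWord n, c ≠ Color.D) :
    pathAction n (wordElt (nthWord n)) ≠ 1 := by
  intro h1
  have hp : pathColors (nthWord n) = (nthWord n).reverse := by
    refine if_neg fun h => ?_
    exact hD _ (List.mem_reverse.1 (List.mem_of_head? h)) rfl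
  have key := ColoredGraph.action_wordElt_reverse _ (pathColors (nthWord n)) (Fin.ofNat _)
    fun i c hc => pathGraph_adj_succ (hu := reduced_pathColors (reduced_nthWord n))
      (hD := head_pathColors (reduced_nthWord n)) hc
  have h2 : (pathColors (nthWord n)).reverse = nthWord n := by rw [hp, List.reverse_reverse]
  rw [h2] at key
  erw [h1] at key
  have h3 := congrArg Fin.val key
  simp only [Equiv.Perm.coe_one, id_eq, Fin.ofNat, Nat.zero_mod,
    Nat.mod_eq_of_lt (Nat.lt_succ_self _)] at h3
  rw [hp, List.length_reverse] at h3
  exact hnil (List.length_eq_zero_iff.1 h3.symm)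

theorem wordElt_ne_one {w : List Color} (hw : Reduced w) (hnil : w ≠ [])
    (hD : ∀ c ∈ w, c ≠ Color.D) : wordElt w ≠ 1 := by
  obtain ⟨n, rfl⟩ := exists_nthWord_eq hw
  intro h
  exact pathAction_ne_one hnil hD (by rw [h, map_one])

/-- The kernel in `⟨A, B, C⟩` of the actions on the paths of the first words. -/
noncomputable def pathKernel (i : ℕ) : Subgroup GamT :=
  ⨅ n : Fin (i + 1), ((pathAction n).comp GamT.subtype).ker

theorem mem_pathKernel {i : ℕ} {g : GamT} :
    g ∈ pathKernel i ↔ ∀ n ≤ i, pathAction n g = 1 := by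
  simp only [pathKernel, Subgroup.mem_iInf, MonoidHom.mem_ker, MonoidHom.comp_apply,
    Subgroup.subtype_apply]
  exact ⟨fun h n hn => h ⟨n, by omega⟩, fun h n => h n (by omega)⟩

theorem pathKernel_normal (i : ℕ) : (pathKernel i).Normal :=
  Subgroup.normal_iInf_normal fun _ => inferInstance

theorem pathKernel_finiteIndex (i : ℕ) : (pathKernel i).FiniteIndex :=
  Subgroup.finiteIndex_iInf fun _ => Subgroup.finiteIndex_ker _

theorem pathKernel_antitone : Antitone pathKernel := by
  intro i j hij g hg
  rw [mem_pathKernel] at hg ⊢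
  exact fun n hn => hg n (hn.trans hij)

theorem iInf_pathKernel : ⨅ i, pathKernel i = ⊥ := by
  rw [eq_bot_iff]
  rintro ⟨g, hg⟩ h
  rw [Subgroup.mem_iInf] at h
  obtain ⟨w, hw, hD, rfl⟩ := exists_reduced_word_GamT hg
  by_cases hnil : w = []
  · subst hnil
    exact Subgroup.mem_bot.2 rfl
  · obtain ⟨n, rfl⟩ := exists_nthWord_eq hw
    exact (pathAction_ne_one hnil hD (mem_pathKernel.1 (h n) n le_rfl)).elim

/-! ### Infinitude of `⟨A, B, C⟩`: the element `AB` has infinite order -/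

theorem replicate_AB_reduced (k : ℕ) :
    Reduced (List.replicate k [Color.A, Color.B]).flatten := by
  induction k with
  | zero => exact List.isChain_nil
  | succ k ih =>
    rw [List.replicate_succ, List.flatten_cons]
    refine List.isChain_cons_cons.2 ⟨by simp, ?_⟩
    cases k with
    | zero => exact List.isChain_singleton _
    | succ k =>
      rw [List.replicate_succ, List.flatten_cons] at ih ⊢
      exact List.isChain_cons_cons.2 ⟨by simp, ih⟩

theorem wordElt_replicate_AB (k : ℕ) :
    wordElt (List.replicate k [Color.A, Color.B]).flatten = (gen Color.A * gen Color.B) ^ k := by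
  induction k with
  | zero => simp [wordElt]
  | succ k ih =>
    rw [List.replicate_succ, List.flatten_cons, wordElt_append, ih, pow_succ']
    simp [wordElt]

instance : Infinite GamT := by
  have hinf : ¬ IsOfFinOrder (genT Color.A (by simp) * genT Color.B (by simp)) := by
    rw [isOfFinOrder_iff_pow_eq_one]
    rintro ⟨k, hk, h⟩
    have h1 : (gen Color.A * gen Color.B) ^ k = 1 := congrArg Subtype.val h
    rw [← wordElt_replicate_AB] at h1
    refine wordElt_ne_one (replicate_AB_reduced k) ?_ ?_ h1
    · obtain ⟨j, rfl⟩ : ∃ j, k = j + 1 := ⟨k - 1, by omega⟩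
      simp [List.replicate_succ]
    · intro c hc
      simp only [List.mem_flatten, List.mem_replicate] at hc
      obtain ⟨l, ⟨-, rfl⟩, hc⟩ := hc
      rcases List.mem_pair.1 hc with rfl | rfl <;> simp
  exact Infinite.of_injective _ (injective_pow_iff_not_isOfFinOrder.2 hinf)

/-! ### Quotients of `⟨A, B, C⟩` with Cayley graphs of large diameter -/

theorem exists_notMem_words (L : ℕ) :
    ∃ g : GamT, ∀ w hw, w.length < L → wordEltT w hw ≠ g := by
  have hfin : (Subtype.val ⁻¹' (wordElt '' {w | w.length < L}) : Set GamT).Finite :=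
    ((List.finite_length_lt Color L).image _).preimage Subtype.val_injective.injOn
  obtain ⟨g, hg⟩ := hfin.exists_notMem
  exact ⟨g, fun w hw hL h => hg ⟨w, hL, congrArg Subtype.val h⟩⟩

theorem exists_cayleyGraph {N : ℕ → Subgroup GamT} (hnormal : ∀ i, (N i).Normal)
    (hfin : ∀ i, (N i).FiniteIndex) (hanti : Antitone N) (hbot : ⨅ i, N i = ⊥) (L : ℕ) :
    ∃ (i : ℕ) (H : ColoredGraph (GamT ⧸ N i)), H.Adj = cayleyAdj (N i) ∧ H.toSimple.Connected ∧
      L ≤ H.toSimple.diam := by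
  obtain ⟨g, hg⟩ := exists_notMem_words L
  -- Avoiding `F1` excludes loops, avoiding `F2` excludes edges with two colors, and avoiding `F3`
  -- keeps the coset of `g` distinct from those of all words shorter than `L`, hence at distance at
  -- least `L` from the identity.
  let F1 : Set GamT := Set.range fun c : {c : Color // c ≠ Color.D} => genT c.1 c.2
  let F2 : Set GamT := Set.range fun p : {p : Color × Color //
    p.1 ≠ Color.D ∧ p.2 ≠ Color.D ∧ p.1 ≠ p.2} => genT p.1.1 p.2.1 * genT p.1.2 p.2.2.1
  let F3 : Set GamT := (fun h => h⁻¹ * g) '' {h | ∃ w hw, w.length < L ∧ wordEltT w hw = h}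
  have hF3 : F3.Finite := by
    refine Set.Finite.image _ (Set.Finite.subset
      (((List.finite_length_lt Color L).image wordElt).preimage Subtype.val_injective.injOn) ?_)
    rintro _ ⟨w, hw, hL, rfl⟩
    exact ⟨w, hL, rfl⟩
  have h1F : (1 : GamT) ∉ F1 ∪ F2 ∪ F3 := by
    rintro ((⟨⟨c, hc⟩, h⟩ | ⟨⟨⟨c, d⟩, hc, hd, hcd⟩, h⟩) | ⟨_, ⟨w, hw, hL, rfl⟩, h⟩)
    · refine wordElt_ne_one (w := [c]) (List.isChain_singleton _) (by simp) (by simpa using hc) ?_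
      simpa [wordElt, genT] using congrArg Subtype.val h
    · refine wordElt_ne_one (w := [c, d]) (List.isChain_pair.2 hcd) (by simp) ?_ ?_
      · intro a ha
        rcases List.mem_pair.1 ha with rfl | rfl
        exacts [hc, hd]
      · simpa [wordElt, genT] using congrArg Subtype.val h
    · exact hg w hw hL (inv_mul_eq_one.1 h)
  obtain ⟨i, hi⟩ := exists_forall_notMem hanti hbot
    (((Set.finite_range _).union (Set.finite_range _)).union hF3) h1F
  have := hnormal i
  have := hfin i
  have h1 : ∀ c hc, genT c hc ∉ N i := fun c hc => hi _ (Or.inl (Or.inl ⟨⟨c, hc⟩, rfl⟩))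
  have h2 : ∀ c d hc hd, c ≠ d → genT c hc * genT d hd ∉ N i := fun c d hc hd hcd =>
    hi _ (Or.inl (Or.inr ⟨⟨(c, d), hc, hd, hcd⟩, rfl⟩))
  have hconn := connected_cayleyGraph (N i) h1 h2
  refine ⟨i, cayleyGraph (N i) h1 h2, rfl, hconn, le_trans ?_ (SimpleGraph.dist_le_diam
    (SimpleGraph.connected_iff_ediam_ne_top.1 hconn) (u := QuotientGroup.mk 1)
    (v := QuotientGroup.mk g))⟩
  obtain ⟨p, hp⟩ := hconn.exists_walk_length_eq_dist (QuotientGroup.mk 1) (QuotientGroup.mk g)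
  obtain ⟨w, hw, hlen, h⟩ := exists_word_of_walk p
  by_contra! hlt
  rw [QuotientGroup.mk_one, one_mul] at h
  exact hi _ (Or.inr ⟨_, ⟨w, hw, by omega, rfl⟩, rfl⟩) (QuotientGroup.eq.1 h.symm)

/-! ### Carrying out the construction -/

theorem two_pow_le_scale {m : ℕ} (hm : 2 ≤ m) (G : ℕ → Marked) (i : ℕ) : 2 ^ i ≤ scale m G i :=
  (Nat.pow_le_pow_left hm i).trans (Nat.le_mul_of_pos_right _ (by positivity))

theorem nonempty_stepChoice {m : ℕ} (hm : 2 ≤ m) {N : ℕ → Subgroup GamT}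
    (hnormal : ∀ i, (N i).Normal) (hfin : ∀ i, (N i).FiniteIndex) (hanti : Antitone N)
    (hbot : ⨅ i, N i = ⊥) (G : ℕ → Marked) {n : ℕ} (hn : 0 < n) :
    Nonempty (StepChoice m N G n) := by
  classical
  obtain ⟨W, hW, H, he, ho, hconn, hdiam⟩ : ∃ (W : Type) (_ : Finite W) (H : ColoredGraph W),
      (Even n → ∃ (i : ℕ) (e : W ≃ Fin (2 * i)), IsColorIso H.Adj (cycleAdj i) e) ∧
      (Odd n → ∃ (i : ℕ) (e : W ≃ GamT ⧸ N i), IsColorIso H.Adj (cayleyAdj (N i)) e) ∧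
      H.toSimple.Connected ∧ 10 * scale m G n ≤ H.toSimple.diam := by
    rcases Nat.even_or_odd n with h | h
    -- The cycle needs `i ≥ 2`: for `i = 1` its single edge would carry both colors.
    · have hi : 2 ≤ 10 * scale m G n + 2 := by omega
      exact ⟨_, inferInstance, cycleGraph _ hi, fun _ => ⟨_, Equiv.refl _, fun _ _ _ => Iff.rfl⟩,
        fun h' => (Nat.not_even_iff_odd.2 h' h).elim, connected_cycleGraph hi,
        le_trans (by omega) (le_diam_cycleGraph hi)⟩
    · obtain ⟨i, H, hH, hconn, hdiam⟩ :=
        exists_cayleyGraph hnormal hfin hanti hbot (10 * scale m G n)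
      have := hfin i
      exact ⟨_, inferInstance, H, fun h' => (Nat.not_even_iff_odd.2 h h').elim,
        fun _ => ⟨i, Equiv.refl _, fun _ _ _ => by rw [hH]; rfl⟩, hconn, hdiam⟩
  have := hconn.nonempty
  have hs := two_pow_le_scale hm G
  have hdn : 4 * (n + 1) ≤ H.toSimple.diam := by
    have h1 : n < 2 ^ n := Nat.lt_two_pow_self
    have h2 := hs n
    omega
  obtain ⟨cls, hle, hsep, hcov⟩ := exists_net_partition hconn _ hs n hdn
  obtain ⟨x, r, hxr, hx, hr, -⟩ := exists_two_unassigned hconn _ hs n (by omega) cls hle hsep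
    hconn.nonempty.some
  obtain ⟨z, hz, -⟩ := hcov n (Finset.mem_Icc.2 ⟨hn, le_rfl⟩) x
  -- The vertices left free after `n` nets become `R_{n+1}`; relabelling `0` as `n + 1` does not
  -- affect the other classes.
  have hiff : ∀ i ∈ Finset.Icc 1 n, ∀ y, (if cls y = 0 then n + 1 else cls y) = i ↔ cls y = i := by
    intro i hi y
    rw [Finset.mem_Icc] at hi
    split_ifs <;> omega
  exact ⟨{
    W := W
    H := H
    shape_even := he
    shape_odd := ho
    diam_ge := hdiam
    cls := fun y => if cls y = 0 then n + 1 else cls y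
    cls_mem := by
      intro y
      have := hle y
      rw [Finset.mem_Icc]
      split_ifs <;> omega
    net := fun i hi a b hab ha hb => hsep i hi a b hab ((hiff i hi a).1 ha) ((hiff i hi b).1 hb)
    cover := by
      intro i hi a
      obtain ⟨p, hp, hpa⟩ := hcov i hi a
      exact ⟨p, (hiff i hi p).2 hp, hpa⟩
    z := z
    cls_z := (hiff n (Finset.mem_Icc.2 ⟨hn, le_rfl⟩) z).2 hz
    x := x
    cls_x := if_pos hx
    r := r
    cls_r := if_pos hr
    r_ne_x := hxr.symm }⟩

/-- A choice depends only on the graphs already constructed. -/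
theorem StepChoice.exists_result_eq {m : ℕ} {N : ℕ → Subgroup GamT} {G G' : ℕ → Marked} {n : ℕ}
    (hn : 0 < n) (h : ∀ i < n, G i = G' i) (S : StepChoice m N G n) :
    ∃ S' : StepChoice m N G' n, S.result = S'.result := by
  have hscale : ∀ i ∈ Finset.Icc 1 n, scale m G i = scale m G' i := by
    intro i hi
    rw [Finset.mem_Icc] at hi
    rw [scale, scale, h (i - 1) (by omega)]
  let S' : StepChoice m N G' n := {
    W := S.W
    H := S.H
    shape_even := S.shape_even
    shape_odd := S.shape_odd
    diam_ge := by
      rw [← hscale n (Finset.mem_Icc.2 ⟨hn, le_rfl⟩)]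
      exact S.diam_ge
    cls := S.cls
    cls_mem := S.cls_mem
    net := fun i hi => by
      rw [← hscale i hi]
      exact S.net i hi
    cover := fun i hi => by
      rw [← hscale i hi]
      exact S.cover i hi
    z := S.z
    cls_z := S.cls_z
    x := S.x
    cls_x := S.cls_x
    r := S.r
    cls_r := S.cls_r
    r_ne_x := S.r_ne_x }
  -- The glued graph depends on proofs about the positions, so positions and pieces are replaced as
  -- variables rather than rewritten in place.
  have key : ∀ (p : S.Site → S.W) (P : S.Site → Marked) (hp : Function.Injective p)
      (hr : ∀ j, p j ≠ S.r), S.pos = p → S.part = P →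
      S.result = glue S.H S.no_D p hp P S.r hr := by
    rintro _ _ _ _ rfl rfl
    rfl
  refine ⟨S', key S'.pos S'.part S'.pos_injective S'.pos_ne_r (funext fun j => ?_)
    (funext fun j => ?_)⟩
  · rcases j with ⟨a, ha⟩ | ⟨⟨⟩⟩ | ⟨⟨⟩⟩ <;> rfl
  · rcases j with ⟨a, ha⟩ | ⟨⟨⟩⟩ | ⟨⟨⟩⟩
    · exact h (S.cls a - 1) (by omega)
    · exact h (n - 1) (by omega)
    · rfl

/-- The isomorphism given by an equality. -/
def MarkedIso.ofEq {M M' : Marked} (h : M = M') : MarkedIso M M' where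
  toEquiv := h ▸ Equiv.refl _
  isColorIso := by
    subst h
    exact fun _ _ _ => Iff.rfl
  map_root := by
    subst h
    rfl

theorem nonempty_construction {m : ℕ} (hm : 2 ≤ m) : Nonempty (Construction m) := by
  classical
  have hchoice : ∀ (G : ℕ → Marked) (n : ℕ), Nonempty (StepChoice m pathKernel G (n + 2)) :=
    fun G n => nonempty_stepChoice hm pathKernel_normal pathKernel_finiteIndex pathKernel_antitone
      iInf_pathKernel G (by omega)
  -- `F k` is a full sequence whose entries below `k + 2` are final. Each step overwrites the entry
  -- `k + 2`, so the diagonal is the desired sequence, and the choice made for `F k` transfers to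
  -- it.
  let F : ℕ → (ℕ → Marked) := fun k => Nat.rec
    (fun i => if i = 0 then singleVertex else firstStep singleVertex 0 1 (by simp))
    (fun k G => Function.update G (k + 2) (hchoice G k).some.result) k
  have hF : ∀ k, F (k + 1) = Function.update (F k) (k + 2) (hchoice (F k) k).some.result :=
    fun _ => rfl
  have hstable : ∀ k l i, i < k + 2 → F (k + l) i = F k i := by
    intro k l i hi
    induction l with
    | zero => rfl
    | succ l ih =>
      rw [← add_assoc, hF, Function.update_of_ne (by omega), ih]
  let G : ℕ → Marked := fun n => F n n
  have hG : ∀ k, ∀ i < k + 2, F k i = G i := by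
    intro k i hi
    rcases le_total i k with h | h
    · obtain ⟨l, rfl⟩ := Nat.exists_eq_add_of_le h
      exact hstable i l i (by omega)
    · obtain ⟨l, rfl⟩ := Nat.exists_eq_add_of_le h
      exact (hstable k l _ hi).symm
  have hstep : ∀ k, ∃ S : StepChoice m pathKernel G (k + 2), G (k + 2) = S.result := by
    intro k
    obtain ⟨S, hS⟩ := (hchoice (F k) k).some.exists_result_eq (by omega) (hG k)
    refine ⟨S, ?_⟩
    rw [← hS, ← hG (k + 1) (k + 2) (by omega), hF, Function.update_self]
  choose S hS using hstep
  exact ⟨{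
    N := pathKernel
    normal := pathKernel_normal
    finiteIndex := pathKernel_finiteIndex
    antitone := pathKernel_antitone
    iInf_eq_bot := iInf_pathKernel
    G := G
    zero := MarkedIso.ofEq rfl
    q := 0
    r₁ := 1
    q_ne_r₁ := by simp
    one := MarkedIso.ofEq rfl
    choice := S
    step := fun k => MarkedIso.ofEq (hS k) }⟩

theorem mainTheorem8 (m : ℕ) (hm : 10 < m) :
    Nonempty (Construction m) ∧
    ∀ K : Construction m,
      Function.Injective K.graph.action ∧
      (∀ x y : K.Vertex, ∃ g : Gam, K.graph.action g x = y) ∧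
      AmenableAction K.graph.action ∧
      StronglyAmenable (schreierGraph K.graph.action) ∧
      ExhaustingSmallBoundary K.graph.toSimple K.subgraphSet ∧
      FolnerSequence K.graph.action K.subgraphSet :=
  ⟨nonempty_construction (by omega), fun K => ⟨K.action_injective,
    K.action_transitive (by omega), K.amenableAction, K.stronglyAmenable (by omega),
    K.exhaustingSmallBoundary_subgraphSet, K.folnerSequence_subgraphSet⟩⟩
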